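/- For a finite simple graph $G$, let $\lambda(G)$ denote its spectral radius, i.e. the maximum of the absolute values of the eigenvalues of its adjacency matrix. Let $P_k$ be the path with $k$ vertices and $K_m$ the complete graph with $m$ vertices; a graph is $P_k$-free if it contains no (not necessarily induced) subgraph isomorphic to $P_k$. For integers $s\ge 0$, $m\ge 2s$ and $n\ge m-s$, let $W_{n,m,s}$ be the graph on $n$ vertices whose vertex set is partitioned into $X,Y,Z$ with $|X|=s$, $|Y|=m-2s$, $|Z|=n-(m-s)$, and whose edges are all pairs of distinct vertices in $X\cup Y$ and all pairs between $X$ and $Z$. **Theorem.** Let $n\ge k\ge 4$ be integers and $t=\lfloor k/2\rfloor-1$. Let $G$ be an $n$-vertex $P_k$-free graph whose spectral radius is maximum among all $n$-vertex $P_k$-free graphs. Then $$\lambda(G)=\max\bigl(\{\lambda(W_{n,k-1,s}) : 1\le s\le t\}\cup\{\lambda(K_{k-1})\}\bigr).$$ -/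

import Mathlib

open Classical in
/-- The real adjacency matrix of a graph on a finite vertex set is Hermitian (symmetric). -/
theorem adjMatrix_isHermitian_real {V : Type*} [Fintype V] (G : SimpleGraph V) :
    (G.adjMatrix ℝ).IsHermitian := by
  rw [Matrix.IsHermitian, Matrix.conjTranspose_eq_transpose_of_trivial]
  exact G.transpose_adjMatrix (α := ℝ)

open Classical in
/-- The spectral radius of a graph: the maximum of the absolute values of the eigenvalues
of its adjacency matrix (a finite family of reals, indexed by the vertices). -/
noncomputable def graphSpectralRadius {V : Type*} [Fintype V] (G : SimpleGraph V) : ℝ :=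
  ⨆ i : V, |(adjMatrix_isHermitian_real G).eigenvalues i|

/-- The graph `W_{n,k,s}` on `n` vertices (for `2 * s ≤ k` and `k - s ≤ n`).  The vertices `0, …, s - 1`
form the part `X`, the vertices `s, …, k - s - 1` the part `Y` (so `|Y| = k - 2 * s`), and
the vertices `k - s, …, n - 1` the part `Z`.  The edges are all pairs inside `X ∪ Y` and all pairs
between `X` and `Z`. -/
def graphW (n k s : ℕ) : SimpleGraph (Fin n) where
  Adj u v := u ≠ v ∧
    ((u.val < k - s ∧ v.val < k - s) ∨
      (u.val < s ∧ k - s ≤ v.val) ∨ (v.val < s ∧ k - s ≤ u.val))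
  symm := ⟨fun u v h => ⟨h.1.symm, by have := h.2; tauto⟩⟩
  loopless := ⟨fun u h => h.1 rfl⟩

/-! The spectral radius is the largest Rayleigh quotient (`adjForm_le`), attained at some
nonnegative vector `x` (`exists_nonneg_le_adjForm`). Number the vertices so that `x` decreases. A
Kelmans transformation along an edge, towards the smaller index, does not decrease the form at `x`,
and it does not lengthen the longest path (`exists_isPathList_of_kelmans`). Hence `G` may be
replaced by a compressed `P_k`-free graph (`exists_isCompressed`).

A compressed graph is the comparability graph of a rooted forest: the earlier neighbours of a vertex
form a chain, whose length is the `depth` of the vertex. A tree in which, for every `s` with `2 * s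
+ 2 ≤ k`, at least `k - 1 - 2 * s` vertices lie deeper than `s` contains `P_k`
(`exists_isPathList_of_depth`). In a `P_k`-free tree on `N` vertices this fails for some `s`, and a
rearrangement bounds its form by that of `W_{N,k-1,s}` at the same vector
(`adjForm_le_adjForm_graphW`). For `s = 0` the latter graph is `K_{k-1}` with isolated vertices.
Adding the bounds over the trees shows that the radius of `G` is at most the largest candidate.

Conversely, every candidate is a radius of a `P_k`-free graph or of a subgraph of one: `W_{n,k-1,s}`
is `P_k`-free (`graphW_free`), and `K_{k-1}` embeds in `W_{n,k-1,0}`. -/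

section

open Finset

/-! ### Rayleigh quotients and the spectral radius -/

section SpectralRadius

variable {V W : Type*} [Fintype V] [Fintype W]

open Classical in
/-- The quadratic form of the adjacency matrix of `G`. -/
noncomputable def adjForm (G : SimpleGraph V) (x : V → ℝ) : ℝ :=
  ∑ u, ∑ v, if G.Adj u v then x u * x v else 0

open Classical in
theorem dotProduct_adjMatrix_mulVec (G : SimpleGraph V) (x y : V → ℝ) :
    x ⬝ᵥ (G.adjMatrix ℝ).mulVec y = ∑ u, ∑ v, if G.Adj u v then x u * y v else 0 := by
  simp only [dotProduct, Matrix.mulVec, SimpleGraph.adjMatrix_apply, Finset.mul_sum, ite_mul,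
    one_mul, zero_mul, mul_ite, mul_zero]

open Classical in
theorem abs_eigenvalues_le_graphSpectralRadius (G : SimpleGraph V) (i : V) :
    |(adjMatrix_isHermitian_real G).eigenvalues i| ≤ graphSpectralRadius G :=
  le_ciSup (f := fun i => |(adjMatrix_isHermitian_real G).eigenvalues i|)
    (Set.finite_range _).bddAbove i

theorem graphSpectralRadius_nonneg (G : SimpleGraph V) : 0 ≤ graphSpectralRadius G :=
  Real.iSup_nonneg fun _ => abs_nonneg _

/-- In an orthonormal eigenbasis the form is a sum of squared coordinates weighted by the
eigenvalues. -/
theorem adjForm_le (G : SimpleGraph V) (x : V → ℝ) :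
    adjForm G x ≤ graphSpectralRadius G * ∑ v, x v ^ 2 := by
  classical
  set hA := adjMatrix_isHermitian_real G with hA_def
  set b := hA.eigenvectorBasis
  have hin : ∀ y z : V → ℝ, inner ℝ (WithLp.toLp 2 y) (WithLp.toLp 2 z) = y ⬝ᵥ z := by
    intro y z
    simp [PiLp.inner_apply, dotProduct, mul_comm]
  have hb : ∀ i, inner ℝ (b i) (WithLp.toLp 2 ((G.adjMatrix ℝ).mulVec x)) =
      hA.eigenvalues i * inner ℝ (b i) (WithLp.toLp 2 x) := by
    intro i
    have h1 := hA.mulVec_eigenvectorBasis i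
    have h2 : b i = WithLp.toLp 2 (b i).ofLp := rfl
    rw [h2, hin, hin, Matrix.dotProduct_mulVec, ← Matrix.mulVec_transpose,
      G.transpose_adjMatrix]
    have h3 : (G.adjMatrix ℝ).mulVec (b i).ofLp = hA.eigenvalues i • (b i).ofLp := h1
    rw [h3, smul_dotProduct, smul_eq_mul]
  have hq : adjForm G x = ∑ i, hA.eigenvalues i * (inner ℝ (b i) (WithLp.toLp 2 x)) ^ 2 := by
    have : adjForm G x = x ⬝ᵥ (G.adjMatrix ℝ).mulVec x := by
      rw [dotProduct_adjMatrix_mulVec, adjForm]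
    rw [this, ← hin, ← b.sum_inner_mul_inner]
    refine sum_congr rfl fun i _ => ?_
    rw [hb, real_inner_comm]
    ring
  have hn : ∑ v, x v ^ 2 = ∑ i, (inner ℝ (b i) (WithLp.toLp 2 x)) ^ 2 := by
    have h := b.sum_sq_norm_inner_right (WithLp.toLp 2 x)
    simp only [Real.norm_eq_abs, sq_abs] at h
    rw [h, EuclideanSpace.norm_sq_eq]
    simp
  rw [hq, hn, mul_sum]
  refine sum_le_sum fun i _ => ?_
  exact mul_le_mul_of_nonneg_right
    ((le_abs_self _).trans (abs_eigenvalues_le_graphSpectralRadius G i)) (sq_nonneg _)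

/-- Take the entrywise absolute value of a unit eigenvector whose eigenvalue has maximal modulus; by
the triangle inequality the form does not fall below that modulus. -/
theorem exists_nonneg_le_adjForm [Nonempty V] (G : SimpleGraph V) :
    ∃ x : V → ℝ, (∀ v, 0 ≤ x v) ∧ 0 < ∑ v, x v ^ 2 ∧
      graphSpectralRadius G * ∑ v, x v ^ 2 ≤ adjForm G x := by
  classical
  set hA := adjMatrix_isHermitian_real G with hA_def
  obtain ⟨i, hi⟩ := exists_eq_ciSup_of_finite (f := fun i => |hA.eigenvalues i|)
  set y : V → ℝ := (hA.eigenvectorBasis i).ofLp with hy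
  have hAy : (G.adjMatrix ℝ).mulVec y = hA.eigenvalues i • y := hA.mulVec_eigenvectorBasis i
  have hsq : ∑ v, y v ^ 2 = 1 := by
    have h : ‖hA.eigenvectorBasis i‖ ^ 2 = 1 := by simp
    rw [EuclideanSpace.norm_sq_eq] at h
    simpa using h
  have hform : adjForm G y = hA.eigenvalues i := by
    have h1 : adjForm G y = y ⬝ᵥ (G.adjMatrix ℝ).mulVec y := by
      rw [dotProduct_adjMatrix_mulVec, adjForm]
    have h2 : y ⬝ᵥ y = 1 := by
      rw [← hsq]; simp [dotProduct, sq]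
    rw [h1, hAy, dotProduct_smul, h2, smul_eq_mul, mul_one]
  refine ⟨fun v => |y v|, fun v => abs_nonneg _, ?_, ?_⟩
  · simp [hsq]
  · simp only [sq_abs, hsq, mul_one]
    have : graphSpectralRadius G = |hA.eigenvalues i| := hi.symm
    rw [this, ← hform, adjForm]
    refine (abs_sum_le_sum_abs _ _).trans (sum_le_sum fun u _ => ?_)
    refine (abs_sum_le_sum_abs _ _).trans (sum_le_sum fun v _ => ?_)
    split_ifs <;> simp [abs_mul]

/-- Monotonicity of the form of a nonnegative vector under an injective homomorphism. -/
theorem adjForm_le_adjForm_extend {G : SimpleGraph V} {H : SimpleGraph W} (f : V → W)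
    (hf : Function.Injective f) (hadj : ∀ u v, G.Adj u v → H.Adj (f u) (f v))
    {x : V → ℝ} (hx : ∀ v, 0 ≤ x v) :
    adjForm G x ≤ adjForm H (Function.extend f x 0) := by
  classical
  have h0 : ∀ w, 0 ≤ Function.extend f x 0 w := by
    intro w
    by_cases hw : ∃ v, f v = w
    · obtain ⟨v, rfl⟩ := hw
      rw [hf.extend_apply]; exact hx v
    · rw [Function.extend_apply' _ _ _ hw]; simp
  have hterm : ∀ a b, 0 ≤ (if H.Adj a b then
      Function.extend f x 0 a * Function.extend f x 0 b else 0) := by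
    intro a b
    split_ifs
    · exact mul_nonneg (h0 _) (h0 _)
    · exact le_rfl
  have key : ∀ F : W → ℝ, (∀ w, 0 ≤ F w) → ∑ v, F (f v) ≤ ∑ w, F w := by
    intro F hF
    rw [← sum_image (s := univ) (g := f) (f := F) (fun a _ b _ h => hf h)]
    exact sum_le_sum_of_subset_of_nonneg (subset_univ _) fun w _ _ => hF w
  unfold adjForm
  refine le_trans (sum_le_sum fun u _ => ?_)
    (key (fun a => ∑ b, if H.Adj a b then
      Function.extend f x 0 a * Function.extend f x 0 b else 0)
      fun a => sum_nonneg fun b _ => hterm a b)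
  refine le_trans (sum_le_sum fun v _ => ?_)
    (key (fun b => if H.Adj (f u) b then
      Function.extend f x 0 (f u) * Function.extend f x 0 b else 0)
      fun b => hterm (f u) b)
  by_cases h : G.Adj u v
  · simp [h, hadj u v h, hf.extend_apply]
  · simp only [h, if_false]
    exact hterm _ _

theorem sum_sq_extend (f : V → W) (hf : Function.Injective f) (x : V → ℝ) :
    ∑ w, Function.extend f x 0 w ^ 2 = ∑ v, x v ^ 2 := by
  classical
  have h : ∑ w ∈ univ.image f, Function.extend f x 0 w ^ 2 = ∑ v, x v ^ 2 := by
    rw [sum_image fun a _ b _ h => hf h]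
    exact sum_congr rfl fun v _ => by rw [hf.extend_apply]
  rw [← h]
  refine (sum_subset (subset_univ _) fun w _ hw => ?_).symm
  rw [Function.extend_apply' _ _ _ fun ⟨v, hv⟩ => hw (mem_image.2 ⟨v, mem_univ _, hv⟩)]
  simp

theorem graphSpectralRadius_mono {G : SimpleGraph V} {H : SimpleGraph W} (f : V → W)
    (hf : Function.Injective f) (hadj : ∀ u v, G.Adj u v → H.Adj (f u) (f v)) :
    graphSpectralRadius G ≤ graphSpectralRadius H := by
  cases isEmpty_or_nonempty V
  · rw [graphSpectralRadius, Real.iSup_of_isEmpty]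
    exact graphSpectralRadius_nonneg H
  · obtain ⟨x, hx, hpos, hle⟩ := exists_nonneg_le_adjForm G
    have h := (hle.trans (adjForm_le_adjForm_extend f hf hadj hx)).trans (adjForm_le H _)
    rw [sum_sq_extend f hf] at h
    exact le_of_mul_le_mul_right h hpos

theorem adjForm_top (x : V → ℝ) :
    adjForm (⊤ : SimpleGraph V) x = (∑ v, x v) ^ 2 - ∑ v, x v ^ 2 := by
  classical
  have h : ∀ u, (∑ v, if (⊤ : SimpleGraph V).Adj u v then x u * x v else 0) =
      x u * ∑ v, x v - x u ^ 2 := by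
    intro u
    have h1 : ∀ v, (if (⊤ : SimpleGraph V).Adj u v then x u * x v else 0) =
        x u * x v - if u = v then x u * x v else 0 := by
      intro v
      by_cases huv : u = v <;> simp [huv]
    rw [sum_congr rfl fun v _ => h1 v, sum_sub_distrib, ← mul_sum]
    simp [sq]
  have h2 : adjForm (⊤ : SimpleGraph V) x = ∑ u, (x u * ∑ v, x v - x u ^ 2) :=
    sum_congr rfl fun u _ => by rw [← h u]; congr!
  rw [h2, sum_sub_distrib, ← sum_mul, sq]

/-- Compare with the complete graph and apply Cauchy–Schwarz to the sum of the entries. -/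
theorem adjForm_le_card_sub_one (G : SimpleGraph V) {x : V → ℝ} (hx : ∀ v, 0 ≤ x v) :
    adjForm G x ≤ ((Fintype.card V : ℝ) - 1) * ∑ v, x v ^ 2 := by
  have h := adjForm_le_adjForm_extend (G := G) (H := ⊤) id Function.injective_id
    (fun u v h => h.ne) hx
  have he : Function.extend id x 0 = x := by
    funext v
    exact Function.injective_id.extend_apply x 0 v
  rw [he, adjForm_top] at h
  have h2 := sq_sum_le_card_mul_sum_sq (s := univ) (f := x)
  rw [card_univ] at h2
  linarith

theorem card_sub_one_le_graphSpectralRadius_top [Nonempty V] :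
    (Fintype.card V : ℝ) - 1 ≤ graphSpectralRadius (⊤ : SimpleGraph V) := by
  have h := adjForm_le (⊤ : SimpleGraph V) 1
  rw [adjForm_top] at h
  simp only [Pi.one_apply, sum_const, card_univ, nsmul_eq_mul, mul_one, one_pow] at h
  have hp : (0 : ℝ) < Fintype.card V := by exact_mod_cast Fintype.card_pos
  refine le_of_mul_le_mul_right ?_ hp
  linarith

end SpectralRadius

/-! ### Paths as lists, and longest paths in `W_{n,k-1,s}` -/

section Paths

variable {V W : Type*}

/-- `l` lists the successive vertices of a path in `G`. -/
def IsPathList (G : SimpleGraph V) (l : List V) : Prop :=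
  l.Nodup ∧ l.IsChain G.Adj

theorem IsPathList.map {G : SimpleGraph V} {H : SimpleGraph W} {l : List V}
    (hl : IsPathList G l) (f : V → W) (hf : Function.Injective f)
    (hadj : ∀ u v, G.Adj u v → H.Adj (f u) (f v)) : IsPathList H (l.map f) :=
  ⟨hl.1.map hf, (List.isChain_map f).2 (hl.2.imp fun u v h => hadj u v h)⟩

/-- Lists allow paths to be cut, reversed and concatenated; the inequality on the length replaces
truncation to exactly `k` vertices. -/
theorem pathGraph_isContained_iff {G : SimpleGraph V} {k : ℕ} :
    (SimpleGraph.pathGraph k).IsContained G ↔ ∃ l, IsPathList G l ∧ k ≤ l.length := by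
  constructor
  · rintro ⟨c⟩
    refine ⟨List.ofFn c.toHom, ⟨List.nodup_ofFn.2 c.injective', ?_⟩, by simp⟩
    rw [List.isChain_iff_getElem]
    intro i hi
    simp only [List.getElem_ofFn]
    exact c.toHom.map_adj (SimpleGraph.pathGraph_adj.2 (Or.inl rfl))
  · rintro ⟨l, ⟨hn, hc⟩, hk⟩
    have hadj : ∀ i (hi : i + 1 < l.length), G.Adj l[i] l[i + 1] :=
      List.isChain_iff_getElem.1 hc
    refine ⟨⟨⟨fun i => l[i.val]'(i.isLt.trans_le hk), ?_⟩, ?_⟩⟩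
    · intro a b hab
      rcases SimpleGraph.pathGraph_adj.1 hab with h | h
      · have := hadj a (by have := b.isLt; omega)
        simpa [h] using this
      · have := hadj b (by have := a.isLt; omega)
        simpa [h] using this.symm
    · intro a b hab
      exact Fin.ext ((List.Nodup.getElem_inj_iff hn).1 hab)

theorem free_pathGraph_of_embedding {G : SimpleGraph V} {H : SimpleGraph W} {k : ℕ} (f : V → W)
    (hf : Function.Injective f) (hadj : ∀ u v, G.Adj u v → H.Adj (f u) (f v))
    (hH : (SimpleGraph.pathGraph k).Free H) : (SimpleGraph.pathGraph k).Free G := by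
  intro h
  obtain ⟨l, hl, hk⟩ := pathGraph_isContained_iff.1 h
  exact hH (pathGraph_isContained_iff.2 ⟨l.map f, hl.map f hf hadj, by simpa using hk⟩)

/-- The graph `W_{n,k-1,s}` has no path on `k` vertices when `2 * s + 2 ≤ k`. -/
theorem graphW_free (n k s : ℕ) (hs : 2 * s + 2 ≤ k) :
    (SimpleGraph.pathGraph k).Free (graphW n (k - 1) s) := by
  classical
  rintro ⟨c⟩
  set f : Fin k → Fin n := fun i => c.toHom i with hf
  have hinj : Function.Injective f := c.injective'
  have hadj : ∀ i j : Fin k, i.val + 1 = j.val → (graphW n (k - 1) s).Adj (f i) (f j) :=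
    fun i j h => c.toHom.map_adj (SimpleGraph.pathGraph_adj.2 (Or.inl h))
  set X : Finset (Fin k) := univ.filter fun i => (f i).val < s with hX
  set Y : Finset (Fin k) := univ.filter fun i => s ≤ (f i).val ∧ (f i).val < k - 1 - s with hY
  set Z : Finset (Fin k) := univ.filter fun i => k - 1 - s ≤ (f i).val with hZ
  have hcard : X.card + Y.card + Z.card = k := by
    have hXY : Disjoint X Y := disjoint_filter.2 fun i _ h1 h2 => by omega
    have hXYZ : Disjoint (X ∪ Y) Z := by
      rw [disjoint_union_left]
      exact ⟨disjoint_filter.2 fun i _ h1 h2 => by omega,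
        disjoint_filter.2 fun i _ h1 h2 => by omega⟩
    rw [← card_union_of_disjoint hXY, ← card_union_of_disjoint hXYZ]
    have : X ∪ Y ∪ Z = univ := by
      ext i
      simp only [hX, hY, hZ, mem_union, mem_filter, mem_univ, true_and, iff_true]
      omega
    rw [this, card_univ, Fintype.card_fin]
  have hXs : X.card ≤ s := by
    have := card_le_card_of_injOn (s := X) (t := range s) (fun i => (f i).val)
      (fun i hi => by simpa [hX] using hi) (fun a _ b _ h => hinj (Fin.ext h))
    simpa using this
  have hYs : Y.card ≤ k - 1 - s - s := by
    have := card_le_card_of_injOn (s := Y) (t := Ico s (k - 1 - s)) (fun i => (f i).val)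
      (fun i hi => by simpa [hY] using hi) (fun a _ b _ h => hinj (Fin.ext h))
    simpa using this
  have hsucc : ∀ T : Finset (Fin k),
      (∀ i ∈ T, ∀ j : Fin k, i.val + 1 = j.val → j ∈ X) → T.card ≤ X.card + 1 := by
    intro T hT
    -- The extra value `k` serves the last position of the path, which has no successor.
    have h := card_le_card_of_injOn (s := T) (t := insert k (X.image fun i => i.val))
      (fun i => i.val + 1) ?_ (fun a _ b _ h => Fin.ext (Nat.succ_injective h))
    · refine h.trans ((card_insert_le _ _).trans ?_)
      gcongr
      exact card_image_le
    · intro i hi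
      simp only [coe_insert, coe_image, Set.mem_insert_iff, Set.mem_image, mem_coe]
      by_cases hik : i.val + 1 < k
      · exact Or.inr ⟨⟨i.val + 1, hik⟩, hT i hi _ rfl, rfl⟩
      · left
        have := i.isLt
        omega
  have hZsucc : ∀ i ∈ Z, ∀ j : Fin k, i.val + 1 = j.val → j ∈ X := by
    intro i hi j hij
    have h := (hadj i j hij).2
    simp only [hZ, hX, mem_filter, mem_univ, true_and] at hi ⊢
    omega
  rcases Y.eq_empty_or_nonempty with hYe | hYne
  · have := hsucc Z hZsucc
    rw [hYe, card_empty] at hcard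
    omega
  -- The last visit to `Y` is followed by a vertex of `X` or ends the path, so `m` can be counted
  -- together with `Z`. This saves the one vertex needed: `k ≤ 2 * |X| + |Y| ≤ k - 1`.
  · set m := Y.max' hYne with hm
    have hmY : m ∈ Y := Y.max'_mem hYne
    have hmZ : m ∉ Z := by
      simp only [hZ, hY, mem_filter, mem_univ, true_and] at hmY ⊢
      omega
    have := hsucc (insert m Z) (by
      intro i hi j hij
      rcases mem_insert.1 hi with rfl | hi
      · have h := (hadj _ j hij).2
        have hjY : j ∉ Y := fun hj => by
          have := Y.le_max' j hj
          rw [← hm, Fin.le_def] at this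
          omega
        simp only [hY, hX, mem_filter, mem_univ, true_and] at hmY hjY ⊢
        omega
      · exact hZsucc i hi j hij)
    rw [card_insert_of_notMem hmZ] at this
    omega

end Paths

/-! ### The Kelmans transformation -/

section Compression

variable {V : Type*}

theorem List.IsChain.imp_of_forall_mem {R S : V → V → Prop} {l : List V}
    (h : ∀ a ∈ l, ∀ b ∈ l, R a b → S a b) (hl : l.IsChain R) : l.IsChain S := by
  rw [List.isChain_iff_getElem] at hl ⊢
  exact fun i hi => h _ (List.getElem_mem _) _ (List.getElem_mem _) (hl i hi)

/-- The Kelmans transformation: every neighbour of `u` that is neither `v` nor adjacent to `v`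
is disconnected from `u` and connected to `v`. -/
def kelmans (G : SimpleGraph V) (u v : V) : SimpleGraph V where
  Adj a b := (G.Adj a b ∧ ¬(a = u ∧ G.Adj u b ∧ ¬G.Adj v b ∧ b ≠ v) ∧
      ¬(b = u ∧ G.Adj u a ∧ ¬G.Adj v a ∧ a ≠ v)) ∨
    (a = v ∧ G.Adj u b ∧ ¬G.Adj v b ∧ b ≠ v) ∨ (b = v ∧ G.Adj u a ∧ ¬G.Adj v a ∧ a ≠ v)
  symm := ⟨fun a b h => by
    have := G.adj_comm a b
    tauto⟩
  loopless := ⟨fun a h => by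
    have := G.loopless.irrefl a
    tauto⟩

variable {G : SimpleGraph V} {u v : V}

theorem kelmans_adj_of_ne {a b : V} (ha : a ≠ v) (hb : b ≠ v)
    (h : (kelmans G u v).Adj a b) : G.Adj a b := by
  rcases h with h | h | h
  · exact h.1
  · exact absurd h.1 ha
  · exact absurd h.1 hb

theorem adj_or_adj_of_kelmans_adj {w : V} (h : (kelmans G u v).Adj v w) :
    G.Adj u w ∨ G.Adj v w := by
  rcases h with h | h | h
  · exact Or.inr h.1
  · exact Or.inl h.2.1
  · exact absurd rfl h.2.2.2

/-- Only common neighbours stay attached to `u`, so the path neighbours of `u` other than `v` can be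
joined to `v` instead. -/
theorem adj_and_adj_of_kelmans_adj {w : V} (huv : u ≠ v) (hw : w ≠ v) (h : (kelmans G u v).Adj u w) :
    G.Adj u w ∧ G.Adj v w := by
  rcases h with h | h | h
  · exact ⟨h.1, by have := h.1; have := h.2.1; tauto⟩
  · exact absurd h.1 huv
  · exact absurd h.1 hw

theorem isChain_of_kelmans {l : List V} (hv : v ∉ l)
    (hl : l.IsChain (kelmans G u v).Adj) : l.IsChain G.Adj :=
  hl.imp_of_forall_mem fun _ ha _ hb h =>
    kelmans_adj_of_ne (ne_of_mem_of_not_mem ha hv) (ne_of_mem_of_not_mem hb hv) h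

/-- A path of the transformed graph on which `v` has a neighbour from `N(v)` before it and
a neighbour from `N(u)` after it. -/
theorem exists_isPathList_of_kelmans_aux (hadj : G.Adj u v) {A B : List V} {a b : V}
    (hl : IsPathList (kelmans G u v) ((A ++ [a]) ++ v :: (b :: B)))
    (ha : G.Adj v a) (hb : G.Adj u b) (hau : a ≠ u) (hbu : b ≠ u) :
    ∃ l', IsPathList G l' ∧ ((A ++ [a]) ++ v :: (b :: B)).length ≤ l'.length := by
  obtain ⟨hn, hc⟩ := hl
  rw [List.isChain_append] at hc
  obtain ⟨hc1, hc2, -⟩ := hc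
  have hc3 := (List.isChain_cons.1 hc2).2
  have hv1 : v ∉ A ++ [a] := fun h => by
    have := List.disjoint_of_nodup_append hn h
    simp at this
  have hv2 : v ∉ b :: B := (List.nodup_cons.1 (List.Nodup.of_append_right hn)).1
  have hg1 := isChain_of_kelmans hv1 hc1
  have hg3 := isChain_of_kelmans hv2 hc3
  -- If `u` is on the path, the segment between `u` and `v` is reversed so that each of the two gets
  -- neighbours it has in `G`; if not, `u` is inserted between `v` and `b`.
  by_cases huA : u ∈ A
  · obtain ⟨A1, A2, rfl⟩ := List.append_of_mem huA
    rw [List.append_assoc, List.cons_append] at hc1 hg1 hv1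
    rw [List.isChain_append, List.isChain_cons] at hc1 hg1
    refine ⟨A1 ++ v :: ((A2 ++ [a]).reverse ++ u :: (b :: B)), ⟨?_, ?_⟩, ?_⟩
    · refine List.Perm.nodup ?_ hn
      rw [List.append_assoc, List.append_assoc, List.cons_append, ← List.append_assoc A2]
      refine List.Perm.append_left A1 ?_
      refine (List.perm_middle (a := v) (l₁ := u :: (A2 ++ [a]))).trans ?_
      refine List.Perm.cons _ ?_
      rw [List.cons_append]
      refine (List.perm_middle (a := u)).symm.trans ?_
      exact List.Perm.append_right _ (List.reverse_perm _).symm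
    · rw [List.isChain_append, List.isChain_cons, List.isChain_append, List.isChain_cons]
      refine ⟨hg1.1, ⟨?_, ?_, ⟨?_, hg3⟩, ?_⟩, ?_⟩
      · simpa using ha
      · rw [List.isChain_reverse]
        exact hg1.2.1.2.imp fun _ _ h => h.symm
      · simpa using hb
      · intro x hx y hy
        obtain rfl : u = y := by simpa using hy
        rw [List.getLast?_reverse] at hx
        exact (hg1.2.1.1 x hx).symm
      · intro x hx y hy
        obtain rfl : v = y := by simpa using hy
        have h1 := hc1.2.2 x hx u (by simp)
        have hxv : x ≠ v := by
          rintro rfl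
          exact hv1 (List.mem_append_left _ (List.mem_of_getLast? hx))
        exact (adj_and_adj_of_kelmans_adj hadj.ne hxv h1.symm).2.symm
    · simp only [List.length_append, List.length_cons, List.length_nil, List.length_reverse]
      omega
  · by_cases huB : u ∈ B
    · obtain ⟨B1, B2, rfl⟩ := List.append_of_mem huB
      rw [← List.cons_append] at hc3 hg3 hv2
      rw [List.isChain_append, List.isChain_cons (x := u)] at hc3 hg3
      refine ⟨(A ++ [a]) ++ v :: ((b :: B1).reverse ++ u :: B2), ⟨?_, ?_⟩, ?_⟩
      · refine List.Perm.nodup ?_ hn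
        refine List.Perm.append_left _ (List.Perm.cons _ ?_)
        rw [← List.cons_append]
        exact List.Perm.append_right _ (List.reverse_perm _).symm
      · rw [List.isChain_append, List.isChain_cons, List.isChain_append (l₁ := (b :: B1).reverse),
          List.isChain_cons (x := u)]
        refine ⟨hg1, ⟨?_, ?_, ⟨?_, hg3.2.1.2⟩, ?_⟩, ?_⟩
        · intro y hy
          have hy' : y ∈ (b :: B1).getLast? := by
            rw [← List.head?_reverse]
            rw [List.head?_append_of_ne_nil _ (by simp)] at hy
            exact hy
          have h1 := hc3.2.2 y hy' u (by simp)
          have hyv : y ≠ v := by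
            rintro rfl
            exact hv2 (List.mem_append_left _ (List.mem_of_getLast? hy'))
          exact (adj_and_adj_of_kelmans_adj hadj.ne hyv h1.symm).2
        · rw [List.isChain_reverse]
          exact hg3.1.imp fun _ _ h => h.symm
        · intro y hy
          exact hg3.2.1.1 y hy
        · intro x hx y hy
          obtain rfl : u = y := by simpa using hy
          rw [List.getLast?_reverse] at hx
          obtain rfl : b = x := by simpa using hx
          exact hb.symm
        · intro x hx y hy
          obtain rfl : v = y := by simpa using hy
          obtain rfl : a = x := by simpa using hx
          exact ha.symm
      · simp
    · refine ⟨(A ++ [a]) ++ v :: u :: (b :: B), ⟨?_, ?_⟩, by simp⟩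
      · have h1 : u ∉ (A ++ [a]) ++ v :: (b :: B) := by
          simp only [List.mem_append, List.mem_cons, List.not_mem_nil, or_false, not_or]
          exact ⟨⟨huA, hau.symm⟩, hadj.ne, hbu.symm, huB⟩
        refine List.Perm.nodup ?_ (List.nodup_cons.2 ⟨h1, hn⟩)
        refine (List.perm_middle (a := u)).symm.trans ?_
        exact List.Perm.append_left _ (List.Perm.swap _ _ _)
      · rw [List.isChain_append, List.isChain_cons, List.isChain_cons]
        refine ⟨hg1, ⟨?_, ?_, hg3⟩, ?_⟩
        · simpa using hadj.symm
        · simpa using hb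
        · intro x hx y hy
          obtain rfl : v = y := by simpa using hy
          obtain rfl : a = x := by simpa using hx
          exact ha.symm

theorem IsPathList.reverse {l : List V} (hl : IsPathList G l) : IsPathList G l.reverse :=
  ⟨List.nodup_reverse.2 hl.1, List.isChain_reverse.2 (hl.2.imp fun _ _ h => h.symm)⟩

/-- Along an edge, the Kelmans transformation does not lengthen the longest path. -/
theorem exists_isPathList_of_kelmans (hadj : G.Adj u v) {l : List V}
    (hl : IsPathList (kelmans G u v) l) : ∃ l', IsPathList G l' ∧ l.length ≤ l'.length := by
  classical
  by_cases hv : v ∈ l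
  swap
  · exact ⟨l, ⟨hl.1, isChain_of_kelmans hv hl.2⟩, le_rfl⟩
  obtain ⟨A, B, rfl⟩ := List.append_of_mem hv
  have hc := hl.2
  rw [List.isChain_append, List.isChain_cons] at hc
  obtain ⟨hcA, ⟨hvB, hcB⟩, hAv⟩ := hc
  have hAv' : ∀ w ∈ A.getLast?, (kelmans G u v).Adj v w :=
    fun w hw => (hAv w hw v (by simp)).symm
  have hvA : v ∉ A := fun h => by
    have := List.disjoint_of_nodup_append hl.1 h
    simp at this
  have hvnB : v ∉ B := (List.nodup_cons.1 (List.Nodup.of_append_right hl.1)).1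
  by_cases h1 : (∀ w ∈ A.getLast?, G.Adj v w) ∧ ∀ w ∈ B.head?, G.Adj v w
  · refine ⟨_, ⟨hl.1, ?_⟩, le_rfl⟩
    rw [List.isChain_append, List.isChain_cons]
    refine ⟨isChain_of_kelmans hvA hcA, ⟨h1.2, isChain_of_kelmans hvnB hcB⟩, ?_⟩
    intro x hx y hy
    obtain rfl : v = y := by simpa using hy
    exact (h1.1 x hx).symm
  -- Both path neighbours of `v` suit `u`: exchanging the roles of `u` and `v` gives a path of `G`.
  by_cases h2 : (∀ w ∈ A.getLast?, w = u ∨ G.Adj u w) ∧ ∀ w ∈ B.head?, w = u ∨ G.Adj u w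
  · have hsw : ∀ a b, a ≠ v → b ≠ v → (kelmans G u v).Adj a b →
        G.Adj (Equiv.swap u v a) (Equiv.swap u v b) := by
      intro a b ha hb hab
      have hg := kelmans_adj_of_ne ha hb hab
      by_cases hau : a = u
      · subst hau
        rw [Equiv.swap_apply_left, Equiv.swap_apply_of_ne_of_ne hg.ne' hb]
        exact (adj_and_adj_of_kelmans_adj hadj.ne hb hab).2
      · by_cases hbu : b = u
        · subst hbu
          rw [Equiv.swap_apply_left, Equiv.swap_apply_of_ne_of_ne hau ha]
          exact (adj_and_adj_of_kelmans_adj hadj.ne ha hab.symm).2.symm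
        · rwa [Equiv.swap_apply_of_ne_of_ne hau ha, Equiv.swap_apply_of_ne_of_ne hbu hb]
    have hswv : ∀ w, w ≠ v → (w = u ∨ G.Adj u w) →
        G.Adj (Equiv.swap u v v) (Equiv.swap u v w) := by
      rintro w hw (rfl | h)
      · simpa using hadj
      · rwa [Equiv.swap_apply_right, Equiv.swap_apply_of_ne_of_ne h.ne' hw]
    refine ⟨(A ++ v :: B).map (Equiv.swap u v),
      ⟨hl.1.map (Equiv.swap u v).injective, ?_⟩, by simp⟩
    rw [List.isChain_map, List.isChain_append, List.isChain_cons]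
    refine ⟨?_, ⟨?_, ?_⟩, ?_⟩
    · exact hcA.imp_of_forall_mem fun a ha b hb h =>
        hsw a b (fun e => hvA (e ▸ ha)) (fun e => hvA (e ▸ hb)) h
    · exact fun w hw => hswv w (fun e => hvnB (e ▸ List.mem_of_head? hw)) (h2.2 w hw)
    · exact hcB.imp_of_forall_mem fun a ha b hb h =>
        hsw a b (fun e => hvnB (e ▸ ha)) (fun e => hvnB (e ▸ hb)) h
    · intro x hx y hy
      obtain rfl : v = y := by simpa using hy
      exact (hswv x (fun e => hvA (e ▸ List.mem_of_getLast? hx)) (h2.1 x hx)).symm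
  have key : ∀ w, (kelmans G u v).Adj v w → ¬G.Adj v w → G.Adj u w ∧ w ≠ u := by
    intro w hw hn
    have h := (adj_or_adj_of_kelmans_adj hw).resolve_right hn
    exact ⟨h, h.ne'⟩
  have key2 : ∀ w, (kelmans G u v).Adj v w → ¬(w = u ∨ G.Adj u w) → G.Adj v w ∧ w ≠ u := by
    intro w hw hn
    push Not at hn
    exact ⟨(adj_or_adj_of_kelmans_adj hw).resolve_left hn.2, hn.1⟩
  -- What remains is the mixed case: one path neighbour of `v` is adjacent to `v` but not to `u`,
  -- the other to `u` but not to `v`.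
  have hsplit : ∃ a b A' B', A = A' ++ [a] ∧ B = b :: B' ∧
      ((G.Adj v a ∧ G.Adj u b ∧ a ≠ u ∧ b ≠ u) ∨ (G.Adj u a ∧ G.Adj v b ∧ a ≠ u ∧ b ≠ u)) := by
    have hA : ∀ w, w ∈ A.getLast? → ∃ A', A = A' ++ [w] := by
      intro w hw
      exact List.getLast?_eq_some_iff.1 hw
    have hB : ∀ w, w ∈ B.head? → ∃ B', B = w :: B' := by
      intro w hw
      exact List.head?_eq_some_iff.1 hw
    rw [not_and_or] at h1 h2
    push Not at h1 h2
    rcases h1 with ⟨w, hw, hvw⟩ | ⟨w, hw, hvw⟩ <;>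
      rcases h2 with ⟨z, hz, hzu, huz⟩ | ⟨z, hz, hzu, huz⟩
    · obtain rfl : w = z := Option.mem_unique hw hz
      exact absurd (key w (hAv' w hw) hvw).1 huz
    · obtain ⟨A', hA'⟩ := hA w hw
      obtain ⟨B', hB'⟩ := hB z hz
      have k1 := key w (hAv' w hw) hvw
      have k2 := key2 z (hvB z hz) (by tauto)
      exact ⟨w, z, A', B', hA', hB', Or.inr ⟨k1.1, k2.1, k1.2, k2.2⟩⟩
    · obtain ⟨A', hA'⟩ := hA z hz
      obtain ⟨B', hB'⟩ := hB w hw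
      have k1 := key w (hvB w hw) hvw
      have k2 := key2 z (hAv' z hz) (by tauto)
      exact ⟨z, w, A', B', hA', hB', Or.inl ⟨k2.1, k1.1, k2.2, k1.2⟩⟩
    · obtain rfl : w = z := Option.mem_unique hw hz
      exact absurd (key w (hvB w hw) hvw).1 huz
  obtain ⟨a, b, A', B', rfl, rfl, h | h⟩ := hsplit
  · exact exists_isPathList_of_kelmans_aux hadj hl h.1 h.2.1 h.2.2.1 h.2.2.2
  · have hr := hl.reverse
    have he : (A' ++ [a] ++ v :: b :: B').reverse =
        (B'.reverse ++ [b]) ++ v :: (a :: A'.reverse) := by simp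
    rw [he] at hr
    obtain ⟨l', hl', hlen⟩ :=
      exists_isPathList_of_kelmans_aux hadj hr h.2.1 h.1 h.2.2.2 h.2.2.1
    refine ⟨l', hl', ?_⟩
    rwa [← he, List.length_reverse] at hlen

theorem kelmans_free (hadj : G.Adj u v) {k : ℕ} (hG : (SimpleGraph.pathGraph k).Free G) :
    (SimpleGraph.pathGraph k).Free (kelmans G u v) := by
  intro h
  obtain ⟨l, hl, hk⟩ := pathGraph_isContained_iff.1 h
  obtain ⟨l', hl', hlen⟩ := exists_isPathList_of_kelmans hadj hl
  exact hG (pathGraph_isContained_iff.2 ⟨l', hl', hk.trans hlen⟩)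

-- The summand is arbitrary because the identity serves twice: for the form at `x`, and for the
-- total index minimised in `exists_isCompressed`.
open Classical in
theorem sum_kelmans_adj [Fintype V] (huv : u ≠ v) (F : V → V → ℝ) :
    (∑ a, ∑ b, if (kelmans G u v).Adj a b then F a b else 0) =
      (∑ a, ∑ b, if G.Adj a b then F a b else 0) +
        ∑ w ∈ univ.filter (fun w => G.Adj u w ∧ ¬G.Adj v w ∧ w ≠ v),
          ((F v w - F u w) + (F w v - F w u)) := by
  set D : V → Prop := fun w => G.Adj u w ∧ ¬G.Adj v w ∧ w ≠ v with hD
  have h : ∀ a b, (if (kelmans G u v).Adj a b then F a b else 0) =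
      (if G.Adj a b then F a b else 0) +
        (((if a = v then (if D b then F v b else 0) else 0) -
          (if a = u then (if D b then F u b else 0) else 0)) +
        ((if b = v then (if D a then F a v else 0) else 0) -
          (if b = u then (if D a then F a u else 0) else 0))) := by
    intro a b
    have h1 : ¬D u := fun h => G.loopless.irrefl u h.1
    have h2 : ¬D v := fun h => h.2.2 rfl
    have h3 : (kelmans G u v).Adj a b ↔ (G.Adj a b ∧ ¬(a = u ∧ D b) ∧ ¬(b = u ∧ D a)) ∨
      (a = v ∧ D b) ∨ (b = v ∧ D a) := Iff.rfl
    have h4 : D b → ¬ G.Adj v b := fun h => h.2.1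
    have h5 : D a → ¬ G.Adj a v := fun h h' => h.2.1 h'.symm
    have h6 : D b → G.Adj u b := fun h => h.1
    have h7 : D a → G.Adj a u := fun h => h.1.symm
    have h8 : u ≠ v := huv
    rw [if_congr h3 rfl rfl]
    by_cases hau : a = u
    · subst hau
      by_cases hbu : b = a
      · subst hbu; simp [h1, h8]
      by_cases hbv : b = v
      · subst hbv; simp [h1, h2, h8, h8.symm]
      · by_cases hDb : D b <;> simp [h1, hbu, hbv, h8, hDb, h6]
    · by_cases hav : a = v
      · subst hav
        by_cases hbu : b = u
        · subst hbu; simp [h1, h2, h8, h8.symm]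
        by_cases hbv : b = a
        · subst hbv; simp [h2, h8.symm]
        · by_cases hDb : D b <;> simp [h2, hbu, hbv, h8.symm, hDb, h4]
      · by_cases hbu : b = u
        · subst hbu
          by_cases hDa : D a <;> simp [hau, hav, h8, hDa, h7]
        · by_cases hbv : b = v
          · subst hbv
            by_cases hDa : D a <;> simp [hau, hav, h8.symm, hDa, h5]
          · simp [hau, hav, hbu, hbv]
  simp only [h, sum_add_distrib, sum_sub_distrib, sum_filter]
  congr 1
  congr 1
  · congr 1
    · rw [sum_comm]; simp [hD]
    · rw [sum_comm]; simp [hD]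
  · congr 1 <;> simp [hD]

end Compression

/-! ### Compressed graphs -/

/-- A graph on a linear order in which the closed neighbourhood of the larger end of every edge
is contained in that of the smaller end. -/
def IsCompressed {α : Type*} [LinearOrder α] (G : SimpleGraph α) : Prop :=
  ∀ i j, i < j → G.Adj i j → ∀ w, G.Adj j w → w = i ∨ G.Adj i w

/-- Among the `P_k`-free graphs whose form at `x` is no smaller, take one with the least sum of edge
indices. An edge violating compression would allow a Kelmans move that strictly lowers this sum. -/
theorem exists_isCompressed {n k : ℕ} (G : SimpleGraph (Fin n))
    (hG : (SimpleGraph.pathGraph k).Free G) {x : Fin n → ℝ} (hx : ∀ v, 0 ≤ x v)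
    (hanti : Antitone x) :
    ∃ H : SimpleGraph (Fin n), (SimpleGraph.pathGraph k).Free H ∧ IsCompressed H ∧
      adjForm G x ≤ adjForm H x := by
  classical
  set S : Set (SimpleGraph (Fin n)) :=
    {H | (SimpleGraph.pathGraph k).Free H ∧ adjForm G x ≤ adjForm H x} with hS
  set wt : SimpleGraph (Fin n) → ℝ := fun H =>
    ∑ a, ∑ b, if H.Adj a b then ((a.val : ℝ) + b.val) else 0 with hwt
  obtain ⟨H, hH, hmin⟩ := Set.exists_min_image S wt (Set.toFinite S) ⟨G, hG, le_rfl⟩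
  refine ⟨H, hH.1, ?_, hH.2⟩
  intro i j hij hadj w hw
  by_contra hcon
  push Not at hcon
  have hne : j ≠ i := hij.ne'
  have h1 : kelmans H j i ∈ S := by
    refine ⟨kelmans_free hadj.symm hH.1, hH.2.trans ?_⟩
    rw [adjForm, adjForm, sum_kelmans_adj hne, le_add_iff_nonneg_right]
    refine sum_nonneg fun z _ => ?_
    have h2 := mul_nonneg (sub_nonneg.2 (hanti hij.le)) (hx z)
    nlinarith
  have h3 := hmin _ h1
  simp only [hwt] at h3
  rw [sum_kelmans_adj hne, le_add_iff_nonneg_right] at h3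
  refine absurd h3 (not_le.2 (sum_neg (fun z _ => ?_) ⟨w, by simpa using ⟨hw, hcon.2, hcon.1⟩⟩))
  have : (i.val : ℝ) < j.val := by exact_mod_cast hij
  linarith

/-! ### The forest structure of a compressed graph -/

section Ancestors

variable {α : Type*} [LinearOrder α] (G : SimpleGraph α) (S : Finset α)

open Classical in
/-- The neighbours of `v` in `S` that precede `v`. -/
noncomputable def ancestors (v : α) : Finset α :=
  S.filter fun a => a < v ∧ G.Adj a v

/-- The number of neighbours of `v` in `S` that precede `v`. -/
noncomputable def depth (v : α) : ℕ := (ancestors G S v).card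

variable {G S}

theorem mem_ancestors {a v : α} : a ∈ ancestors G S v ↔ a ∈ S ∧ a < v ∧ G.Adj a v := by
  classical
  simp [ancestors]

theorem adj_of_mem_ancestors (hG : IsCompressed G) {a b v : α} (ha : a ∈ ancestors G S v)
    (hb : b ∈ ancestors G S v) (hab : a ≠ b) : G.Adj a b := by
  rw [mem_ancestors] at ha hb
  rcases hG b v hb.2.1 hb.2.2 a ha.2.2.symm with h | h
  · exact absurd h hab
  · exact h.symm

theorem ancestors_subset (hG : IsCompressed G) {a v : α} (ha : a ∈ ancestors G S v) :
    ancestors G S a ⊆ ancestors G S v := by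
  intro b hb
  rw [mem_ancestors] at ha hb ⊢
  refine ⟨hb.1, hb.2.1.trans ha.2.1, ?_⟩
  rcases hG b a hb.2.1 hb.2.2 v ha.2.2 with h | h
  · exact absurd (hb.2.1.trans ha.2.1) (by rw [h]; exact lt_irrefl _)
  · exact h

theorem mem_ancestors_of_lt (hG : IsCompressed G) {a b v : α} (ha : a ∈ ancestors G S v)
    (hb : b ∈ ancestors G S v) (hab : a < b) : a ∈ ancestors G S b :=
  mem_ancestors.2 ⟨(mem_ancestors.1 ha).1, hab, adj_of_mem_ancestors hG ha hb hab.ne⟩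

theorem depth_lt_of_mem_ancestors (hG : IsCompressed G) {a v : α} (ha : a ∈ ancestors G S v) :
    depth G S a < depth G S v := by
  refine card_lt_card ((ssubset_iff_of_subset (ancestors_subset hG ha)).2 ⟨a, ha, fun h => ?_⟩)
  exact lt_irrefl a (mem_ancestors.1 h).2.1

/-- The greatest ancestor of `v` has all the other ancestors of `v` among its own, so its depth is
only one less; descend from there. -/
theorem exists_mem_ancestors_depth_eq (hG : IsCompressed G) {v : α} {d : ℕ}
    (hd : d < depth G S v) : ∃ a ∈ ancestors G S v, depth G S a = d := by
  induction hm : depth G S v using Nat.strong_induction_on generalizing v with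
  | _ m ih =>
    subst hm
    have hne : (ancestors G S v).Nonempty := card_pos.1 (lt_of_le_of_lt (Nat.zero_le _) hd)
    set a := (ancestors G S v).max' hne with ha
    have hmem : a ∈ ancestors G S v := max'_mem _ hne
    have hlt := depth_lt_of_mem_ancestors hG hmem
    have hle : depth G S v ≤ depth G S a + 1 := by
      refine (card_le_card (t := insert a (ancestors G S a)) fun b hb => ?_).trans
        (card_insert_le _ _)
      rcases (le_max' _ b hb).eq_or_lt with h | h
      · exact mem_insert.2 (Or.inl h)
      · exact mem_insert_of_mem (mem_ancestors_of_lt hG hb hmem h)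
    rcases (Nat.lt_succ_iff.1 (lt_of_lt_of_le hd hle)).eq_or_lt with h | h
    · exact ⟨a, hmem, h.symm⟩
    · obtain ⟨b, hb, hbd⟩ := ih _ hlt h rfl
      exact ⟨b, ancestors_subset hG hmem hb, hbd⟩

theorem exists_depth_eq (hG : IsCompressed G) {v : α} {d : ℕ}
    (hd : d ≤ depth G S v) : ∃ a, (a = v ∨ a ∈ ancestors G S v) ∧ depth G S a = d := by
  rcases hd.eq_or_lt with h | h
  · exact ⟨v, Or.inl rfl, h.symm⟩
  · obtain ⟨a, ha, had⟩ := exists_mem_ancestors_depth_eq hG h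
    exact ⟨a, Or.inr ha, had⟩

theorem injOn_depth_ancestors (hG : IsCompressed G) (v : α) :
    Set.InjOn (depth G S) (ancestors G S v) := by
  intro a ha b hb hab
  rcases lt_trichotomy a b with h | h | h
  · exact absurd hab (depth_lt_of_mem_ancestors hG (mem_ancestors_of_lt hG ha hb h)).ne
  · exact h
  · exact absurd hab (depth_lt_of_mem_ancestors hG (mem_ancestors_of_lt hG hb ha h)).ne'

end Ancestors

/-! ### Long paths in deep trees -/

section LongPath

variable {α : Type*} {G : SimpleGraph α}

theorem isPathList_toList {K : Finset α} (hK : ∀ a ∈ K, ∀ b ∈ K, a ≠ b → G.Adj a b) :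
    IsPathList G K.toList :=
  ⟨K.nodup_toList, (K.nodup_toList.pairwise_of_forall_ne fun a ha b hb h =>
    hK a (mem_toList.1 ha) b (mem_toList.1 hb) h).isChain⟩

/-- A path can be prolonged by two vertices for each unused vertex of a set `X` of vertices
adjacent to everything in `S`, as long as there are vertices left. -/
theorem exists_isPathList_extend [DecidableEq α] {S : Finset α} (X : Finset α) :
    ∀ l : List α, X ⊆ S → (∀ x ∈ X, ∀ w ∈ S, w ≠ x → G.Adj x w) → l ≠ [] →
      IsPathList G l → (∀ v ∈ l, v ∈ S) → (∀ v ∈ l, v ∉ X) →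
      ∃ l', IsPathList G l' ∧ (∀ v ∈ l', v ∈ S) ∧
        min S.card (l.length + 2 * X.card) ≤ l'.length := by
  induction X using Finset.induction_on with
  | empty =>
    intro l _ _ _ hl hlS _
    exact ⟨l, hl, hlS, by simp⟩
  | insert x X hx ih =>
    intro l hXS hdom hne hl hlS hlX
    have hxS : x ∈ S := hXS (mem_insert_self _ _)
    have hlx : x ∉ l := fun h => hlX x h (mem_insert_self _ _)
    have hadj : ∀ w ∈ l, G.Adj w x := fun w hw =>
      (hdom x (mem_insert_self _ _) w (hlS w hw) (ne_of_mem_of_not_mem hw hlx)).symm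
    by_cases hz : ∃ z ∈ S, z ∉ l ∧ z ∉ insert x X
    · obtain ⟨z, hzS, hzl, hzX⟩ := hz
      rw [mem_insert, not_or] at hzX
      have hxz := hdom x (mem_insert_self _ _) z hzS hzX.1
      have hmem : ∀ w ∈ l ++ [x, z], w ∈ l ∨ w = x ∨ w = z := fun w hw => by
        simpa using hw
      have hpath : IsPathList G (l ++ [x, z]) := by
        refine ⟨List.Nodup.append hl.1 (by simpa using hxz.ne) ?_, ?_⟩
        · intro w hw hw'
          simp only [List.mem_cons, List.not_mem_nil, or_false] at hw'
          rcases hw' with rfl | rfl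
          · exact hlx hw
          · exact hzl hw
        · rw [List.isChain_append]
          refine ⟨hl.2, by simpa using hxz, ?_⟩
          intro w hw y hy
          obtain rfl : x = y := by simpa using hy
          exact hadj w (List.mem_of_getLast? hw)
      obtain ⟨l', hl', hS', hlen⟩ := ih (l ++ [x, z]) ((subset_insert _ _).trans hXS)
        (fun y hy => hdom y (mem_insert_of_mem hy)) (by simp) hpath
        (fun w hw => by
          rcases hmem w hw with hw | rfl | rfl
          · exact hlS w hw
          · exact hxS
          · exact hzS)
        (fun w hw => by
          rcases hmem w hw with hw | rfl | rfl
          · exact fun h => hlX w hw (mem_insert_of_mem h)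
          · exact hx
          · exact hzX.2)
      refine ⟨l', hl', hS', ?_⟩
      rw [card_insert_of_notMem hx]
      simp only [List.length_append, List.length_cons, List.length_nil] at hlen
      omega
    -- No unused vertex remains outside `insert x X`; this set is a clique, and appending it uses up
    -- all of `S`.
    · push Not at hz
      have hclique : IsPathList G (insert x X).toList := isPathList_toList fun a ha b hb h =>
        hdom a ha b (hXS hb) h.symm
      refine ⟨l ++ (insert x X).toList, ⟨?_, ?_⟩, ?_, ?_⟩
      · exact List.Nodup.append hl.1 hclique.1 fun w hw hw' => hlX w hw (mem_toList.1 hw')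
      · rw [List.isChain_append]
        refine ⟨hl.2, hclique.2, ?_⟩
        intro w hw y hy
        have hw := List.mem_of_getLast? hw
        have hy := mem_toList.1 (List.mem_of_head? hy)
        exact (hdom y hy w (hlS w hw) fun h => hlX w hw (h ▸ hy)).symm
      · intro w hw
        rcases List.mem_append.1 hw with hw | hw
        · exact hlS w hw
        · exact hXS (mem_toList.1 hw)
      · refine (min_le_left _ _).trans ?_
        have h1 : S ⊆ l.toFinset ∪ insert x X := by
          intro w hw
          rw [mem_union, List.mem_toFinset]
          by_cases h : w ∈ l
          · exact Or.inl h
          · exact Or.inr (hz w hw h)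
        have h2 := (card_le_card h1).trans (card_union_le _ _)
        rw [List.length_append, length_toList]
        exact h2.trans (Nat.add_le_add_right (List.toFinset_card_le l) _)

open Classical in
/-- A connected compressed graph in which, for every `s ≤ k / 2 - 1`, at least `k - 1 - 2 * s`
vertices have more than `s` ancestors, contains a path on `k` vertices. -/
theorem exists_isPathList_of_depth [LinearOrder α] (hG : IsCompressed G) (S : Finset α) :
    ∀ r ∈ S, (∀ v ∈ S, v ≠ r → r < v ∧ G.Adj r v) → ∀ k : ℕ,
      (∀ s, 2 * s + 2 ≤ k → k - 1 - 2 * s ≤ (S.filter fun v => s < depth G S v).card) →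
      ∃ l, IsPathList G l ∧ (∀ v ∈ l, v ∈ S) ∧ k ≤ l.length := by
  induction S using Finset.strongInduction with
  | H S ih =>
  intro r hrS hr k hk
  have hr0 : depth G S r = 0 := by
    rw [depth, card_eq_zero, eq_empty_iff_forall_notMem]
    intro a ha
    rw [mem_ancestors] at ha
    exact lt_asymm ha.2.1 (hr a ha.1 ha.2.1.ne).1
  have hSk : k ≤ S.card := by
    have hpos : 0 < S.card := card_pos.2 ⟨r, hrS⟩
    by_cases h2 : 2 ≤ k
    · have h := hk 0 (by omega)
      have h3 : (S.filter fun v => 0 < depth G S v) ⊆ S.erase r := by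
        intro v hv
        rw [mem_filter] at hv
        refine mem_erase.2 ⟨?_, hv.1⟩
        rintro rfl
        omega
      have h4 := card_le_card h3
      rw [card_erase_of_mem hrS] at h4
      omega
    · omega
  -- The vertices adjacent to all others form the trunk of the tree, from the root to its first
  -- branching.
  set X := S.filter fun x => ∀ w ∈ S, w ≠ x → G.Adj x w with hX
  have hXS : X ⊆ S := filter_subset _ _
  have hdom : ∀ x ∈ X, ∀ w ∈ S, w ≠ x → G.Adj x w := fun x hx => (mem_filter.1 hx).2
  have hrX : r ∈ X := mem_filter.2 ⟨hrS, fun w hw h => (hr w hw h).2⟩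
  set s0 := X.card with hs0
  have hs0pos : 0 < s0 := card_pos.2 ⟨r, hrX⟩
  by_cases hR : S ⊆ X
  · refine ⟨S.toList, isPathList_toList fun a ha b hb h => hdom a (hR ha) b hb h.symm,
      fun v hv => mem_toList.1 hv, ?_⟩
    rwa [length_toList]
  have hXlt : ∀ x ∈ X, ∀ w ∈ S, w ∉ X → x < w := by
    intro x hx w hw hwX
    by_contra hle
    have hne : w ≠ x := ne_of_mem_of_not_mem hx hwX |>.symm
    have hlt : w < x := lt_of_le_of_ne (not_lt.1 hle) hne
    have hadj := hdom x hx w hw hne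
    refine hwX (mem_filter.2 ⟨hw, fun z hz hzw => ?_⟩)
    by_cases hzx : z = x
    · exact hzx ▸ hadj.symm
    · exact (hG w x hlt hadj.symm z (hdom x hx z hz hzx)).resolve_left hzw
  have hdX : ∀ x ∈ X, depth G S x < s0 := by
    intro x hx
    refine card_lt_card ((ssubset_iff_of_subset fun a ha => ?_).2 ⟨x, hx, fun h => ?_⟩)
    · by_contra haX
      have ha := mem_ancestors.1 ha
      exact lt_asymm ha.2.1 (hXlt x hx a ha.1 haX)
    · exact lt_irrefl x (mem_ancestors.1 h).2.1
  have hXanc : ∀ w ∈ S, w ∉ X → X ⊆ ancestors G S w := fun w hw hwX x hx =>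
    mem_ancestors.2 ⟨hXS hx, hXlt x hx w hw hwX,
      hdom x hx w hw (ne_of_mem_of_not_mem hx hwX).symm⟩
  obtain ⟨w', hw'S, hw'X⟩ := not_subset.1 hR
  obtain ⟨vd, hvd, hvdmax⟩ := exists_max_image (S \ X) (depth G S) ⟨w', by simp [hw'S, hw'X]⟩
  rw [mem_sdiff] at hvd
  -- `r1` is the child of the trunk on the way to a deepest vertex `vd`, and `C` below is the branch
  -- it carries.
  obtain ⟨r1, hr1, hr1d⟩ := exists_depth_eq (d := s0) hG (card_le_card (hXanc vd hvd.1 hvd.2))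
  have hr1S : r1 ∈ S := by
    rcases hr1 with rfl | h
    · exact hvd.1
    · exact (mem_ancestors.1 h).1
  have hr1X : r1 ∉ X := fun h => (hdX r1 h).ne hr1d
  have hr1anc : ancestors G S r1 = X :=
    (eq_of_subset_of_card_le (hXanc r1 hr1S hr1X) hr1d.le).symm
  set C := S.filter fun w => w = r1 ∨ (r1 < w ∧ G.Adj r1 w) with hC
  have hmemC : ∀ w, w ∈ C ↔ w ∈ S ∧ (w = r1 ∨ (r1 < w ∧ G.Adj r1 w)) := fun w => mem_filter
  have hCS : C ⊆ S := filter_subset _ _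
  have hr1C : r1 ∈ C := (hmemC r1).2 ⟨hr1S, Or.inl rfl⟩
  have hCX : ∀ w ∈ C, w ∉ X := by
    intro w hw hwX
    have hlt := hXlt w hwX r1 hr1S hr1X
    rcases ((hmemC w).1 hw).2 with h | h
    · exact hr1X (h ▸ hwX)
    · exact lt_asymm hlt h.1
  have hCss : C ⊂ S := (ssubset_iff_of_subset hCS).2 ⟨r, hrS, fun h => hCX r h hrX⟩
  have hdC : ∀ w ∈ C, depth G S w = s0 + depth G C w := by
    intro w hw
    have hun : ancestors G S w = X ∪ ancestors G C w := by
      refine Subset.antisymm (fun a ha => ?_) (union_subset (hXanc w (hCS hw) (hCX w hw))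
        fun a ha => ?_)
      · rw [mem_union]
        by_cases haX : a ∈ X
        · exact Or.inl haX
        right
        have ha' := mem_ancestors.1 ha
        refine mem_ancestors.2 ⟨(hmemC a).2 ⟨ha'.1, ?_⟩, ha'.2⟩
        rcases ((hmemC w).1 hw).2 with h | h
        · exact absurd (hr1anc ▸ h ▸ ha) haX
        · have hr1w : r1 ∈ ancestors G S w := mem_ancestors.2 ⟨hr1S, h⟩
          rcases lt_trichotomy a r1 with h1 | h1 | h1
          · exact absurd (hr1anc ▸ mem_ancestors_of_lt hG ha hr1w h1) haX
          · exact Or.inl h1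
          · exact Or.inr (mem_ancestors.1 (mem_ancestors_of_lt hG hr1w ha h1)).2
      · have ha := mem_ancestors.1 ha
        exact mem_ancestors.2 ⟨hCS ha.1, ha.2⟩
    rw [depth, hun, card_union_of_disjoint]
    · rfl
    · rw [disjoint_right]
      exact fun a ha => hCX a (mem_ancestors.1 ha).1
  obtain ⟨w0, hw0S, hw0r, hw0⟩ : ∃ w ∈ S, w ≠ r1 ∧ ¬G.Adj r1 w := by
    by_contra hcon
    push Not at hcon
    exact hr1X (mem_filter.2 ⟨hr1S, hcon⟩)
  have hw0X : w0 ∉ X := fun h => hw0 (hdom w0 h r1 hr1S hw0r.symm).symm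
  have hw0C : w0 ∉ C := fun h => by
    rcases ((hmemC w0).1 h).2 with h | h
    · exact hw0r h
    · exact hw0 h.2
  -- `v2` is a deepest vertex in the other branches, so everything deeper than `e` lies in `C`.
  obtain ⟨v2, hv2, hv2max⟩ := exists_max_image ((S \ X) \ C) (depth G S)
    ⟨w0, by simp [hw0S, hw0X, hw0C]⟩
  have hv2R := (mem_sdiff.1 hv2).1
  have hv2C := (mem_sdiff.1 hv2).2
  set e := depth G S v2 with he
  have hev : e ≤ depth G S vd := hvdmax v2 hv2R
  rw [mem_sdiff] at hv2R
  have hse : s0 ≤ e := card_le_card (hXanc v2 hv2R.1 hv2R.2)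
  have hdeep : ∀ v ∈ S, e < depth G S v → v ∈ C := by
    intro v hv hlt
    by_contra hvC
    have hvX : v ∉ X := fun h => by have := hdX v h; omega
    have := hv2max v (by simp [hv, hvX, hvC])
    omega
  have hchain : ∀ d, s0 < d → d ≤ e → ∃ a ∈ C, depth G S a = d := by
    intro d hd hde
    obtain ⟨a, ha, had⟩ := exists_depth_eq (d := d) hG (hde.trans hev)
    refine ⟨a, ?_, had⟩
    have hr1lt : r1 ∈ ancestors G S vd := by
      rcases hr1 with h | h
      · rw [← h] at hev
        omega
      · exact h
    rcases ha with rfl | ha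
    · exact (hmemC a).2 ⟨hvd.1, Or.inr (mem_ancestors.1 hr1lt).2⟩
    · refine (hmemC a).2 ⟨(mem_ancestors.1 ha).1, ?_⟩
      rcases lt_trichotomy a r1 with h1 | h1 | h1
      · have := depth_lt_of_mem_ancestors hG (mem_ancestors_of_lt hG ha hr1lt h1)
        omega
      · exact Or.inl h1
      · exact Or.inr (mem_ancestors.1 (mem_ancestors_of_lt hG hr1lt ha h1)).2
  have hdeepcard : (S.filter fun v => e < depth G S v).card ≤
      (C.filter fun v => e < depth G S v).card :=
    card_le_card fun v hv => by
      rw [mem_filter] at hv ⊢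
      exact ⟨hdeep v hv.1 hv.2, hv.2⟩
  -- The target `k - e - s0` balances the count: `r` adds `1`, the chain `K` adds `e - s0 + 1`, and
  -- each of the other `s0 - 1` trunk vertices adds `2`, for a total of `k`.
  obtain ⟨l1, hl1, hl1C, hl1len⟩ := ih C hCss r1 hr1C
    (fun v hv hne => (((hmemC v).1 hv).2).resolve_left hne) (k - e - s0) (by
      intro s hs
      have hconv : (C.filter fun v => s < depth G C v) =
          C.filter fun v => s + s0 < depth G S v := by
        refine filter_congr fun v hv => ?_
        rw [hdC v hv]
        omega
      rw [hconv]
      -- Beyond depth `e` the branch `C` inherits the count of `S`; between `s + s0` and `e` only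
      -- the chain down to `vd` is used, with one vertex per depth.
      by_cases hcase : e ≤ s + s0
      · refine le_trans ?_ ((hk (s + s0) (by omega)).trans (card_le_card fun v hv => ?_))
        · omega
        · rw [mem_filter] at hv ⊢
          exact ⟨hdeep v hv.1 (by omega), hv.2⟩
      · have hsub : (C.filter fun v => e < depth G S v) ∪
            (C.filter fun v => s + s0 < depth G S v ∧ depth G S v ≤ e) ⊆
            C.filter fun v => s + s0 < depth G S v := by
          intro v hv
          simp only [mem_union, mem_filter] at hv ⊢
          rcases hv with hv | hv
          · exact ⟨hv.1, by omega⟩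
          · exact ⟨hv.1, hv.2.1⟩
        have h1 := card_le_card hsub
        rw [card_union_of_disjoint (disjoint_filter.2 fun v _ h h' => by omega)] at h1
        have h2 : (Ioc (s + s0) e).card ≤
            (C.filter fun v => s + s0 < depth G S v ∧ depth G S v ≤ e).card := by
          refine (card_le_card (t := (C.filter fun v => s + s0 < depth G S v ∧
            depth G S v ≤ e).image (depth G S)) fun d hd => ?_).trans card_image_le
          rw [mem_Ioc] at hd
          obtain ⟨a, ha, had⟩ := hchain d (by omega) hd.2
          exact mem_image.2 ⟨a, mem_filter.2 ⟨ha, by omega⟩, had⟩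
        rw [Nat.card_Ioc] at h2
        by_cases hke : 2 * e + 2 ≤ k
        · have := hk e hke
          omega
        · omega)
  set K := insert v2 (ancestors G S v2 \ X) with hK
  have hKS : ∀ a ∈ K, a ∈ S ∧ a ∉ X ∧ a ∉ C := by
    intro a ha
    rcases mem_insert.1 ha with rfl | ha
    · exact ⟨hv2R.1, hv2R.2, hv2C⟩
    · rw [mem_sdiff] at ha
      have ha' := mem_ancestors.1 ha.1
      refine ⟨ha'.1, ha.2, fun haC => hv2C ((hmemC v2).2 ⟨hv2R.1, Or.inr ?_⟩)⟩
      rcases ((hmemC a).1 haC).2 with rfl | h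
      · exact ha'.2
      · exact (mem_ancestors.1 (ancestors_subset hG ha.1 (mem_ancestors.2 ⟨hr1S, h⟩))).2
  have hKcard : K.card = e - s0 + 1 := by
    rw [hK, card_insert_of_notMem, card_sdiff_of_subset (hXanc v2 hv2R.1 hv2R.2)]
    · rfl
    · intro h
      exact lt_irrefl _ (mem_ancestors.1 (mem_sdiff.1 h).1).2.1
  have hKpath : IsPathList G K.toList := by
    refine isPathList_toList fun a ha b hb hab => ?_
    rcases mem_insert.1 ha with rfl | ha <;> rcases mem_insert.1 hb with hb' | hb'
    · exact absurd hb'.symm hab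
    · exact (mem_ancestors.1 (mem_sdiff.1 hb').1).2.2.symm
    · rw [hb']
      exact (mem_ancestors.1 (mem_sdiff.1 ha).1).2.2
    · exact adj_of_mem_ancestors hG (mem_sdiff.1 ha).1 (mem_sdiff.1 hb').1 hab
  have hrC : r ∉ C := fun h => hCX r h hrX
  have hrK : r ∉ K := fun h => (hKS r h).2.1 hrX
  have hlS : ∀ v ∈ l1 ++ r :: K.toList, v ∈ S ∧ v ∉ X.erase r := by
    intro v hv
    rw [List.mem_append, List.mem_cons, mem_toList] at hv
    rcases hv with hv | rfl | hv
    · exact ⟨hCS (hl1C v hv), fun h => hCX v (hl1C v hv) (mem_of_mem_erase h)⟩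
    · exact ⟨hrS, notMem_erase _ _⟩
    · exact ⟨(hKS v hv).1, fun h => (hKS v hv).2.1 (mem_of_mem_erase h)⟩
  obtain ⟨l, hl, hlSS, hlen⟩ := exists_isPathList_extend (G := G) (S := S) (X.erase r)
    (l1 ++ r :: K.toList) ((erase_subset _ _).trans hXS)
    (fun x hx => hdom x (mem_of_mem_erase hx)) (by simp)
    ⟨by
      refine List.Nodup.append hl1.1 (List.nodup_cons.2 ⟨fun h => hrK (mem_toList.1 h),
        hKpath.1⟩) fun w hw hw' => ?_
      rcases List.mem_cons.1 hw' with rfl | hw'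
      · exact hrC (hl1C _ hw)
      · exact (hKS w (mem_toList.1 hw')).2.2 (hl1C w hw), by
      rw [List.isChain_append, List.isChain_cons]
      refine ⟨hl1.2, ⟨fun y hy => ?_, hKpath.2⟩, fun w hw y hy => ?_⟩
      · have hy := mem_toList.1 (List.mem_of_head? hy)
        exact hdom r hrX y (hKS y hy).1 (ne_of_mem_of_not_mem hy hrK)
      · obtain rfl : r = y := by simpa using hy
        have hw := hl1C w (List.mem_of_getLast? hw)
        exact (hdom r hrX w (hCS hw) (ne_of_mem_of_not_mem hw hrC)).symm⟩
    (fun v hv => (hlS v hv).1) (fun v hv => (hlS v hv).2)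
  refine ⟨l, hl, hlSS, ?_⟩
  rw [card_erase_of_mem hrX, List.length_append, List.length_cons, length_toList, hKcard] at hlen
  refine le_trans (le_min hSk ?_) hlen
  omega

end LongPath

/-! ### Comparison with `W_{N,m,s}` -/

section Domination

/-- Each edge is charged to its larger end. -/
theorem adjForm_eq_two_mul_sum_ancestors {α : Type*} [LinearOrder α] [Fintype α]
    (G : SimpleGraph α) (x : α → ℝ) :
    adjForm G x = 2 * ∑ v, x v * ∑ a ∈ ancestors G univ v, x a := by
  classical
  have h1 : ∀ u v, (if G.Adj u v then x u * x v else 0) =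
      (if u < v ∧ G.Adj u v then x u * x v else 0) +
        (if v < u ∧ G.Adj v u then x u * x v else 0) := by
    intro u v
    rcases lt_trichotomy u v with h | h | h
    · simp [h, h.not_gt]
    · simp [h]
    · simp [h, h.not_gt, G.adj_comm u v]
  have h2 : ∑ u, ∑ v, (if v < u ∧ G.Adj v u then x u * x v else 0) =
      ∑ v, x v * ∑ a ∈ ancestors G univ v, x a := by
    refine sum_congr rfl fun v _ => ?_
    rw [ancestors, sum_filter, mul_sum]
    refine sum_congr rfl fun a _ => ?_
    split_ifs <;> simp
  have h3 : ∑ u, ∑ v, (if u < v ∧ G.Adj u v then x u * x v else 0) =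
      ∑ u, ∑ v, (if v < u ∧ G.Adj v u then x u * x v else 0) := by
    rw [sum_comm]
    exact sum_congr rfl fun u _ => sum_congr rfl fun v _ => by rw [mul_comm]
  have h4 : adjForm G x = ∑ u, ∑ v, ((if u < v ∧ G.Adj u v then x u * x v else 0) +
        (if v < u ∧ G.Adj v u then x u * x v else 0)) :=
    sum_congr rfl fun u _ => sum_congr rfl fun v _ => by rw [← h1]
  rw [h4]
  simp only [sum_add_distrib]
  rw [h3, h2]
  ring

variable {N : ℕ} {y : ℕ → ℝ}

theorem depth_le_val (H : SimpleGraph (Fin N)) (v : Fin N) : depth H univ v ≤ v.val := by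
  have h : ancestors H univ v ⊆ Iio v := fun a ha => mem_Iio.2 (mem_ancestors.1 ha).2.1
  have h2 := card_le_card h
  rwa [Fin.card_Iio] at h2

/-- The ancestors have distinct depths below that of `v`, and an ancestor of depth `i` has index at
least `i`. -/
theorem sum_ancestors_le {H : SimpleGraph (Fin N)} (hH : IsCompressed H) (hy : ∀ i, 0 ≤ y i)
    (hanti : Antitone y) (v : Fin N) :
    ∑ a ∈ ancestors H univ v, y a.val ≤ ∑ i ∈ range (depth H univ v), y i := by
  calc ∑ a ∈ ancestors H univ v, y a.val
      ≤ ∑ a ∈ ancestors H univ v, y (depth H univ a) :=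
        sum_le_sum fun a _ => hanti (depth_le_val H a)
    _ = ∑ i ∈ (ancestors H univ v).image (depth H univ), y i :=
        (sum_image (injOn_depth_ancestors hH v)).symm
    _ ≤ ∑ i ∈ range (depth H univ v), y i := by
        refine sum_le_sum_of_subset_of_nonneg (fun i hi => ?_) fun i _ _ => hy i
        obtain ⟨a, ha, rfl⟩ := mem_image.1 hi
        exact mem_range.2 (depth_lt_of_mem_ancestors hH ha)

theorem sum_ancestors_graphW {m s : ℕ} (hs : 2 * s ≤ m) (v : Fin N) :
    ∑ a ∈ ancestors (graphW N m s) univ v, y a.val =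
      ∑ i ∈ range (if v.val < m - s then v.val else s), y i := by
  have h : (ancestors (graphW N m s) univ v).map Fin.valEmbedding =
      range (if v.val < m - s then v.val else s) := by
    ext i
    simp only [mem_map, mem_ancestors, mem_univ, true_and, Fin.valEmbedding_apply, mem_range]
    constructor
    · rintro ⟨a, ⟨hav, hadj⟩, rfl⟩
      have h2 := hadj.2
      rw [Fin.lt_def] at hav
      split_ifs <;> omega
    · intro hi
      have hv := v.isLt
      have hiv : i < v.val := by split_ifs at hi <;> omega
      refine ⟨⟨i, hiv.trans hv⟩, ⟨hiv, ?_, ?_⟩, rfl⟩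
      · exact Fin.ne_of_lt hiv
      · simp only
        split_ifs at hi <;> omega
  rw [← h, sum_map]
  rfl

/-- If few vertices of a compressed graph have more than `s` ancestors, its form on a
decreasing nonnegative vector is dominated by that of `W_{N,m,s}`. -/
theorem adjForm_le_adjForm_graphW {H : SimpleGraph (Fin N)} (hH : IsCompressed H)
    (hy : ∀ i, 0 ≤ y i) (hanti : Antitone y) {m s : ℕ} (hs : 2 * s + 1 ≤ m)
    (hB : (univ.filter fun v => s < depth H univ v).card + 2 * s + 1 ≤ m) :
    adjForm H (fun v => y v.val) ≤ adjForm (graphW N m s) (fun v => y v.val) := by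
  classical
  rw [adjForm_eq_two_mul_sum_ancestors, adjForm_eq_two_mul_sum_ancestors]
  refine mul_le_mul_of_nonneg_left ?_ zero_le_two
  set B := univ.filter fun v => s < depth H univ v with hBdef
  have hmemB : ∀ v, v ∈ B ↔ s < depth H univ v := fun v => by simp [hBdef]
  set T : ℕ → ℝ := fun d => ∑ i ∈ range d, y i with hT
  have hTmono : Monotone T := fun a b hab =>
    sum_le_sum_of_subset_of_nonneg (range_subset_range.2 hab) fun i _ _ => hy i
  -- The deep vertices are moved, in order, to positions `s + 1, s + 2, …`, which lie below `m - s`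
  -- by `hB`. The proof needs `depth v ≤ g v ≤ v`: the new position has at least as many
  -- predecessors and at least as large an entry.
  set g : Fin N → ℕ := fun v => s + (B.filter fun b => b ≤ v).card with hg
  have hginj : Set.InjOn g B := by
    have hlt : ∀ v ∈ B, ∀ w ∈ B, v < w → g v < g w := by
      intro v _ w hw hvw
      refine Nat.add_lt_add_left (card_lt_card ((ssubset_iff_of_subset fun b hb => ?_).2
        ⟨w, by simp [hw], by simp [hvw]⟩)) s
      rw [mem_filter] at hb ⊢
      exact ⟨hb.1, hb.2.trans hvw.le⟩
    intro v hv w hw hvw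
    rcases lt_trichotomy v w with h | h | h
    · exact absurd hvw (hlt v hv w hw h).ne
    · exact h
    · exact absurd hvw (hlt w hw v hv h).ne'
  have hsplit : ∀ v, ((ancestors H univ v).filter fun a => s < depth H univ a).card +
      ((ancestors H univ v).filter fun a => ¬ s < depth H univ a).card = depth H univ v :=
    fun v => card_filter_add_card_filter_not _
  have hdg : ∀ v ∈ B, depth H univ v ≤ g v := by
    intro v hv
    have h1 : ((ancestors H univ v).filter fun a => ¬ s < depth H univ a).card ≤ s + 1 := by
      have := card_le_card_of_injOn (t := range (s + 1)) (depth H univ)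
        (s := (ancestors H univ v).filter fun a => ¬ s < depth H univ a)
        (fun a ha => by
          have := (mem_filter.1 ha).2
          simp only [coe_range, Set.mem_Iio]
          omega)
        ((injOn_depth_ancestors hH v).mono fun a ha => (mem_filter.1 ha).1)
      simpa using this
    have h2 : ((ancestors H univ v).filter fun a => s < depth H univ a).card + 1 ≤
        (B.filter fun b => b ≤ v).card := by
      rw [← card_insert_of_notMem (a := v)]
      · refine card_le_card fun b hb => ?_
        rcases mem_insert.1 hb with rfl | hb
        · simpa using hv
        · rw [mem_filter] at hb
          exact mem_filter.2 ⟨(hmemB b).2 hb.2, (mem_ancestors.1 hb.1).2.1.le⟩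
      · intro h
        exact lt_irrefl v (mem_ancestors.1 (mem_filter.1 h).1).2.1
    have := hsplit v
    simp only [hg]
    omega
  have hgv : ∀ v ∈ B, g v ≤ v.val := by
    intro v hv
    have h1 : s + 1 ≤ ((ancestors H univ v).filter fun a => ¬ s < depth H univ a).card := by
      have : range (s + 1) ⊆ ((ancestors H univ v).filter
          fun a => ¬ s < depth H univ a).image (depth H univ) := by
        intro d hd
        rw [mem_range] at hd
        have hvB := (hmemB v).1 hv
        obtain ⟨a, ha, had⟩ := exists_mem_ancestors_depth_eq (d := d) hH (by omega : d < depth H univ v)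
        exact mem_image.2 ⟨a, mem_filter.2 ⟨ha, by omega⟩, had⟩
      have := (card_le_card this).trans card_image_le
      rwa [card_range] at this
    have h2 : (B.filter fun b => b ≤ v) ∪
        ((ancestors H univ v).filter fun a => ¬ s < depth H univ a) ⊆ Iic v := by
      intro b hb
      rw [mem_Iic]
      rcases mem_union.1 hb with hb | hb
      · exact (mem_filter.1 hb).2
      · exact (mem_ancestors.1 (mem_filter.1 hb).1).2.1.le
    have h3 := card_le_card h2
    rw [card_union_of_disjoint (disjoint_left.2 fun b hb hb' =>
      absurd ((hmemB b).1 (mem_filter.1 hb).1) (mem_filter.1 hb').2), Fin.card_Iic] at h3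
    simp only [hg]
    omega
  have hgmem : ∀ v ∈ B, s < g v ∧ g v < m - s := by
    intro v hv
    have h1 : 0 < (B.filter fun b => b ≤ v).card := card_pos.2 ⟨v, by simpa using hv⟩
    have h2 : (B.filter fun b => b ≤ v).card ≤ B.card := card_filter_le _ _
    simp only [hg]
    omega
  -- `F j` is what position `j` of `W_{N,m,s}` contributes beyond its first `min s j` ancestors.
  set F : ℕ → ℝ := fun j => if s < j ∧ j < m - s then y j * (T j - T s) else 0 with hF
  have hF0 : ∀ j, 0 ≤ F j := by
    intro j
    simp only [hF]
    split_ifs with h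
    · exact mul_nonneg (hy j) (sub_nonneg.2 (hTmono h.1.le))
    · exact le_rfl
  have hterm : ∀ v : Fin N, y v.val * ∑ a ∈ ancestors H univ v, y a.val ≤
      y v.val * T (min s v.val) + if v ∈ B then F (g v) else 0 := by
    intro v
    have h1 := mul_le_mul_of_nonneg_left (sum_ancestors_le hH hy hanti v) (hy v.val)
    refine h1.trans ?_
    by_cases hv : v ∈ B
    · have hgm := hgmem v hv
      have hgle := hgv v hv
      rw [if_pos hv, min_eq_left (by omega)]
      simp only [hF]
      rw [if_pos hgm]
      have h2 : T (depth H univ v) ≤ T (g v) := hTmono (hdg v hv)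
      have h3 : y v.val * (T (g v) - T s) ≤ y (g v) * (T (g v) - T s) :=
        mul_le_mul_of_nonneg_right (hanti hgle) (sub_nonneg.2 (hTmono hgm.1.le))
      have h4 := mul_le_mul_of_nonneg_left h2 (hy v.val)
      change y v.val * T (depth H univ v) ≤ _
      linarith
    · rw [if_neg hv, add_zero]
      rw [hmemB] at hv
      exact mul_le_mul_of_nonneg_left
        (hTmono (le_min (not_lt.1 hv) (depth_le_val H v))) (hy v.val)
  have hsumB : ∑ v : Fin N, (if v ∈ B then F (g v) else 0) ≤ ∑ v : Fin N, F v.val := by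
    rw [← sum_filter, filter_mem_eq_inter, univ_inter, ← sum_image hginj,
      Fin.sum_univ_eq_sum_range]
    refine sum_le_sum_of_subset_of_nonneg (fun j hj => ?_) fun j _ _ => hF0 j
    obtain ⟨v, hv, rfl⟩ := mem_image.1 hj
    exact mem_range.2 ((hgv v hv).trans_lt v.isLt)
  refine (sum_le_sum fun v _ => hterm v).trans ?_
  rw [sum_add_distrib]
  refine (add_le_add_right hsumB _).trans ?_
  rw [← sum_add_distrib]
  refine (sum_congr rfl fun v _ => ?_).le
  rw [sum_ancestors_graphW (by omega)]
  change _ = y v.val * T _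
  simp only [hF]
  by_cases h1 : v.val < m - s
  · rw [if_pos h1]
    by_cases h2 : s < v.val
    · rw [if_pos ⟨h2, h1⟩, min_eq_left h2.le]
      ring
    · rw [if_neg (by tauto), min_eq_right (not_lt.1 h2), add_zero]
  · rw [if_neg h1, if_neg (by tauto), min_eq_left (by omega), add_zero]

end Domination

/-! ### Summation over the trees of the forest -/

section Components

/-- The form of a graph all of whose edges lie in the range of `f` is the form of the
pulled-back graph. -/
theorem adjForm_comap {V W : Type*} [Fintype V] [Fintype W] {H : SimpleGraph W} (f : V → W)
    (hf : Function.Injective f)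
    (hrange : ∀ u v, H.Adj u v → u ∈ Set.range f) (x : W → ℝ) :
    adjForm (H.comap f) (fun v => x (f v)) = adjForm H x := by
  classical
  refine Fintype.sum_of_injective f hf _ _ (fun u hu => ?_) fun u => ?_
  · exact sum_eq_zero fun v _ => if_neg fun h => hu (hrange u v h)
  · refine Fintype.sum_of_injective f hf _ _ (fun v hv => ?_) fun v => ?_
    · exact if_neg fun h => hv (hrange v (f u) h.symm)
    · simp only [SimpleGraph.comap_adj]

theorem sum_comp_le {V W : Type*} [Fintype V] [Fintype W] (f : V → W)
    (hf : Function.Injective f) {F : W → ℝ} (hF : ∀ w, 0 ≤ F w) :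
    ∑ v, F (f v) ≤ ∑ w, F w := by
  classical
  rw [← sum_image (s := univ) (g := f) (f := F) fun a _ b _ h => hf h]
  exact sum_le_sum_of_subset_of_nonneg (subset_univ _) fun w _ _ => hF w

variable {n k : ℕ} {M : ℝ}

theorem natCast_sub_two_le (hk : 2 ≤ k)
    (hM : graphSpectralRadius (⊤ : SimpleGraph (Fin (k - 1))) ≤ M) : (k : ℝ) - 2 ≤ M := by
  have : Nonempty (Fin (k - 1)) := ⟨⟨0, by omega⟩⟩
  have h := card_sub_one_le_graphSpectralRadius_top (V := Fin (k - 1))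
  rw [Fintype.card_fin, Nat.cast_sub (by omega)] at h
  push_cast at h
  linarith

theorem adjForm_graphW_zero_le {N : ℕ} (hk : 2 ≤ k) (hN : k ≤ N)
    (hM : graphSpectralRadius (⊤ : SimpleGraph (Fin (k - 1))) ≤ M) {x : Fin N → ℝ}
    (hx : ∀ v, 0 ≤ x v) : adjForm (graphW N (k - 1) 0) x ≤ M * ∑ v, x v ^ 2 := by
  have hle : k - 1 ≤ N := by omega
  rw [← adjForm_comap (Fin.castLE hle) (Fin.castLE_injective hle)]
  · refine (adjForm_le_card_sub_one _ fun v => hx _).trans ?_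
    have h1 : ((Fintype.card (Fin (k - 1)) : ℝ) - 1) ≤ M := by
      have : Nonempty (Fin (k - 1)) := ⟨⟨0, by omega⟩⟩
      exact card_sub_one_le_graphSpectralRadius_top.trans hM
    have h2 : 0 ≤ M := (graphSpectralRadius_nonneg _).trans hM
    exact mul_le_mul h1 (sum_comp_le _ (Fin.castLE_injective hle) (F := fun v => x v ^ 2)
      fun v => sq_nonneg _) (sum_nonneg fun v _ => sq_nonneg _) h2
  · intro u v h
    have h2 := h.2
    exact ⟨⟨u.val, by omega⟩, rfl⟩

/-- By the long-path criterion some level `s` has too few deeper vertices, and the comparison with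
`W_{N,k-1,s}` applies; this graph embeds in `W_{n,k-1,s}`. -/
theorem adjForm_le_of_rooted {N : ℕ} (hk : 2 ≤ k) (hNn : N ≤ n) {H : SimpleGraph (Fin N)}
    (hH : IsCompressed H) (hfree : (SimpleGraph.pathGraph k).Free H) (r : Fin N)
    (hr : ∀ v, v ≠ r → r < v ∧ H.Adj r v) {x : Fin N → ℝ} (hx : ∀ v, 0 ≤ x v)
    (hanti : Antitone x) (hM : graphSpectralRadius (⊤ : SimpleGraph (Fin (k - 1))) ≤ M)
    (hW : ∀ s, 1 ≤ s → s ≤ k / 2 - 1 → graphSpectralRadius (graphW n (k - 1) s) ≤ M) :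
    adjForm H x ≤ M * ∑ v, x v ^ 2 := by
  classical
  have hsum : 0 ≤ ∑ v, x v ^ 2 := sum_nonneg fun v _ => sq_nonneg _
  by_cases hNk : N < k
  · refine (adjForm_le_card_sub_one H hx).trans (mul_le_mul_of_nonneg_right ?_ hsum)
    refine le_trans ?_ (natCast_sub_two_le hk hM)
    rw [Fintype.card_fin]
    have : (N : ℝ) + 1 ≤ k := by exact_mod_cast hNk
    linarith
  push Not at hNk
  obtain ⟨s, hs, hcard⟩ : ∃ s, 2 * s + 2 ≤ k ∧
      (univ.filter fun v => s < depth H univ v).card < k - 1 - 2 * s := by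
    by_contra hcon
    push Not at hcon
    obtain ⟨l, hl, -, hlen⟩ := exists_isPathList_of_depth hH univ r (mem_univ r)
      (fun v _ hv => hr v hv) k hcon
    exact hfree (pathGraph_isContained_iff.2 ⟨l, hl, hlen⟩)
  -- Extension by zero keeps the sequence decreasing because `x` is nonnegative.
  set y : ℕ → ℝ := fun i => if h : i < N then x ⟨i, h⟩ else 0 with hy
  have hyx : (fun v : Fin N => y v.val) = x := by
    funext v
    simp [hy]
  have hy0 : ∀ i, 0 ≤ y i := by
    intro i
    simp only [hy]
    split_ifs
    · exact hx _
    · exact le_rfl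
  have hyanti : Antitone y := by
    intro i j hij
    by_cases hj : j < N
    · simp only [hy, hj, hij.trans_lt hj, dif_pos]
      exact hanti hij
    · have : y j = 0 := by simp [hy, hj]
      rw [this]
      exact hy0 i
  have hdom := adjForm_le_adjForm_graphW hH hy0 hyanti (m := k - 1) (s := s) (by omega) (by omega)
  rw [hyx] at hdom
  refine hdom.trans ?_
  rcases Nat.eq_zero_or_pos s with rfl | hspos
  · exact adjForm_graphW_zero_le hk hNk hM hx
  · refine (adjForm_le _ _).trans (mul_le_mul_of_nonneg_right ?_ hsum)
    refine le_trans ?_ (hW s hspos (by omega))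
    exact graphSpectralRadius_mono (Fin.castLE hNn) (Fin.castLE_injective hNn)
      fun u v h => ⟨fun e => h.1 (Fin.castLE_injective hNn e), h.2⟩

/-- Relabelling `C` increasingly by `Fin C.card` preserves ancestors, since `C` contains those of
its members. The bound stays a sum over `C`, so that trees can be added. -/
theorem two_mul_sum_le_of_rooted (hk : 2 ≤ k) {H : SimpleGraph (Fin n)}
    (hH : IsCompressed H) (hfree : (SimpleGraph.pathGraph k).Free H) {C : Finset (Fin n)}
    (hC : ∀ v ∈ C, ancestors H univ v ⊆ C) {r : Fin n} (hrC : r ∈ C)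
    (hr : ∀ v ∈ C, v ≠ r → r < v ∧ H.Adj r v) {x : Fin n → ℝ} (hx : ∀ v, 0 ≤ x v)
    (hanti : Antitone x) (hM : graphSpectralRadius (⊤ : SimpleGraph (Fin (k - 1))) ≤ M)
    (hW : ∀ s, 1 ≤ s → s ≤ k / 2 - 1 → graphSpectralRadius (graphW n (k - 1) s) ≤ M) :
    2 * ∑ v ∈ C, x v * ∑ a ∈ ancestors H univ v, x a ≤ M * ∑ v ∈ C, x v ^ 2 := by
  classical
  set f := C.orderEmbOfFin rfl with hf
  have hmem : ∀ i, f i ∈ C := fun i => orderEmbOfFin_mem C rfl i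
  have hsurj : ∀ v ∈ C, ∃ i, f i = v := by
    intro v hv
    rw [← map_orderEmbOfFin_univ C rfl, mem_map] at hv
    obtain ⟨i, -, hi⟩ := hv
    exact ⟨i, hi⟩
  have hsum : ∀ F : Fin n → ℝ, ∑ v ∈ C, F v = ∑ i, F (f i) := by
    intro F
    conv_lhs => rw [← map_orderEmbOfFin_univ C rfl]
    rw [sum_map]
    rfl
  have hanc : ∀ i, ∑ a ∈ ancestors H univ (f i), x a =
      ∑ a ∈ ancestors (H.comap f) univ i, x (f a) := by
    intro i
    have : ancestors H univ (f i) = (ancestors (H.comap f) univ i).map f.toEmbedding := by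
      ext v
      simp only [mem_map, mem_ancestors, mem_univ, true_and, SimpleGraph.comap_adj]
      constructor
      · intro hv
        obtain ⟨a, rfl⟩ := hsurj v (hC _ (hmem i) (mem_ancestors.2 ⟨mem_univ _, hv⟩))
        exact ⟨a, ⟨f.lt_iff_lt.1 hv.1, hv.2⟩, rfl⟩
      · rintro ⟨a, ha, rfl⟩
        exact ⟨f.lt_iff_lt.2 ha.1, ha.2⟩
    rw [this, sum_map]
    rfl
  have hcomp : IsCompressed (H.comap f) := by
    intro i j hij hadj w hw
    rcases hH (f i) (f j) (f.lt_iff_lt.2 hij) hadj (f w) hw with h | h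
    · exact Or.inl (f.injective h)
    · exact Or.inr h
  obtain ⟨r0, hr0⟩ := hsurj r hrC
  have hbound := adjForm_le_of_rooted (n := n) hk (by simpa using card_le_univ C) hcomp
    (free_pathGraph_of_embedding f f.injective (fun _ _ h => h) hfree) r0
    (fun v hv => by
      have := hr (f v) (hmem v) fun h => hv (f.injective (h.trans hr0.symm))
      rw [← hr0] at this
      exact ⟨f.lt_iff_lt.1 this.1, this.2⟩)
    (x := fun i => x (f i)) (fun i => hx _) (fun i j hij => hanti (f.monotone hij)) hM hW
  rw [adjForm_eq_two_mul_sum_ancestors] at hbound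
  rw [hsum, hsum, sum_congr rfl fun i _ => by rw [hanc i]]
  exact hbound

/-- Split off the tree of the least vertex of `S`: by compression this vertex with its neighbours in
`S` is closed under ancestors, and so is the rest. -/
theorem two_mul_sum_le_of_isCompressed (hk : 2 ≤ k) {H : SimpleGraph (Fin n)}
    (hH : IsCompressed H) (hfree : (SimpleGraph.pathGraph k).Free H) {x : Fin n → ℝ}
    (hx : ∀ v, 0 ≤ x v) (hanti : Antitone x)
    (hM : graphSpectralRadius (⊤ : SimpleGraph (Fin (k - 1))) ≤ M)
    (hW : ∀ s, 1 ≤ s → s ≤ k / 2 - 1 → graphSpectralRadius (graphW n (k - 1) s) ≤ M)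
    (S : Finset (Fin n)) (hS : ∀ v ∈ S, ancestors H univ v ⊆ S) :
    2 * ∑ v ∈ S, x v * ∑ a ∈ ancestors H univ v, x a ≤ M * ∑ v ∈ S, x v ^ 2 := by
  classical
  induction S using Finset.strongInduction with
  | H S ih =>
  rcases S.eq_empty_or_nonempty with rfl | hne
  · simp
  set r := S.min' hne with hr
  have hrS : r ∈ S := min'_mem _ _
  have hrle : ∀ v ∈ S, r ≤ v := fun v hv => min'_le _ _ hv
  set C := S.filter fun v => v = r ∨ H.Adj r v with hC
  have hrC : r ∈ C := by simp [hC, hrS]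
  have hCS : C ⊆ S := filter_subset _ _
  have hCanc : ∀ v ∈ C, ancestors H univ v ⊆ C := by
    intro v hv a ha
    have haS := hS v (hCS hv) ha
    rw [mem_ancestors] at ha
    refine mem_filter.2 ⟨haS, ?_⟩
    rcases (mem_filter.1 hv).2 with rfl | h
    · exact absurd ha.2.1 (not_lt.2 (hrle a haS))
    · rcases hH a v ha.2.1 ha.2.2 r h.symm with h' | h'
      · exact Or.inl h'.symm
      · exact Or.inr h'.symm
  have hSanc : ∀ v ∈ S \ C, ancestors H univ v ⊆ S \ C := by
    intro v hv a ha
    rw [mem_sdiff] at hv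
    have haS := hS v hv.1 ha
    rw [mem_ancestors] at ha
    refine mem_sdiff.2 ⟨haS, fun haC => hv.2 (mem_filter.2 ⟨hv.1, Or.inr ?_⟩)⟩
    rcases (mem_filter.1 haC).2 with h | h
    · exact h ▸ ha.2.2
    · rcases hH r a (lt_of_le_of_ne (hrle a haS) h.ne) h v ha.2.2 with h' | h'
      · have := (hrle a haS).trans_lt ha.2.1
        exact absurd this (by rw [h']; exact lt_irrefl _)
      · exact h'
  have h1 := two_mul_sum_le_of_rooted hk hH hfree hCanc hrC
    (fun v hv hvr => by
      have hadj := (mem_filter.1 hv).2.resolve_left hvr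
      exact ⟨lt_of_le_of_ne (hrle v (hCS hv)) hadj.ne, hadj⟩) hx hanti hM hW
  have h2 := ih (S \ C) (sdiff_ssubset hCS ⟨r, hrC⟩) hSanc
  rw [← sum_sdiff hCS, ← sum_sdiff (f := fun v => x v ^ 2) hCS]
  linarith

end Components

/-- The spectral radius of a graph without a path on `k` vertices is at most any common upper
bound of the spectral radii of the graphs `W_{n,k-1,s}` and of the complete graph on `k - 1`
vertices. -/
theorem graphSpectralRadius_le_of_free {V : Type*} [Fintype V] [Nonempty V] {n k : ℕ} {M : ℝ}
    (hk : 2 ≤ k) (hV : Fintype.card V = n) {G : SimpleGraph V}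
    (hfree : (SimpleGraph.pathGraph k).Free G)
    (hM : graphSpectralRadius (⊤ : SimpleGraph (Fin (k - 1))) ≤ M)
    (hW : ∀ s, 1 ≤ s → s ≤ k / 2 - 1 → graphSpectralRadius (graphW n (k - 1) s) ≤ M) :
    graphSpectralRadius G ≤ M := by
  classical
  obtain ⟨x, hx, hpos, hle⟩ := exists_nonneg_le_adjForm G
  set e := Fintype.equivFinOfCardEq hV with he
  -- Sorting the negated entries puts `x` in decreasing order.
  set φ : Fin n ≃ V := (Tuple.sort fun i => -x (e.symm i)).trans e.symm with hφ
  have hanti : Antitone fun i => x (φ i) := by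
    intro i j hij
    have := Tuple.monotone_sort (fun i => -x (e.symm i)) hij
    simpa [hφ] using this
  have hform : adjForm (G.comap φ) (fun i => x (φ i)) = adjForm G x :=
    adjForm_comap φ φ.injective (fun u _ _ => φ.surjective u) x
  have hsq : ∑ i, x (φ i) ^ 2 = ∑ v, x v ^ 2 := φ.sum_comp fun v => x v ^ 2
  obtain ⟨H, hHfree, hH, hGH⟩ := exists_isCompressed (k := k) (G.comap φ)
    (free_pathGraph_of_embedding φ φ.injective (fun _ _ h => h) hfree)
    (x := fun i => x (φ i)) (fun i => hx _) hanti
  have hbound := two_mul_sum_le_of_isCompressed hk hH hHfree (x := fun i => x (φ i))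
    (fun i => hx _) hanti hM hW univ fun v _ => subset_univ _
  rw [← adjForm_eq_two_mul_sum_ancestors, hsq] at hbound
  rw [hform] at hGH
  exact le_of_mul_le_mul_right (hle.trans (hGH.trans hbound)) hpos

end

/-! ### The extremal radius as the greatest candidate -/

theorem theorem4p8 {V : Type*} [Fintype V] (n k : ℕ) (hk : 4 ≤ k) (hkn : k ≤ n)
    (hV : Fintype.card V = n) (G : SimpleGraph V)
    (hfree : (SimpleGraph.pathGraph k).Free G)
    (hmax : ∀ H : SimpleGraph V, (SimpleGraph.pathGraph k).Free H →
      graphSpectralRadius H ≤ graphSpectralRadius G) :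
    IsGreatest
      ({x : ℝ | ∃ s : ℕ, 1 ≤ s ∧ s ≤ k / 2 - 1 ∧ x = graphSpectralRadius (graphW n (k - 1) s)} ∪
        {graphSpectralRadius (⊤ : SimpleGraph (Fin (k - 1)))})
      (graphSpectralRadius G) := by
  classical
  have : Nonempty V := Fintype.card_pos_iff.1 (by omega)
  set T : Set ℝ :=
    {x : ℝ | ∃ s : ℕ, 1 ≤ s ∧ s ≤ k / 2 - 1 ∧ x = graphSpectralRadius (graphW n (k - 1) s)} ∪
      {graphSpectralRadius (⊤ : SimpleGraph (Fin (k - 1)))} with hT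
  have hTW : ∀ s, 1 ≤ s → s ≤ k / 2 - 1 → graphSpectralRadius (graphW n (k - 1) s) ∈ T :=
    fun s h1 h2 => Or.inl ⟨s, h1, h2, rfl⟩
  have hTK : graphSpectralRadius (⊤ : SimpleGraph (Fin (k - 1))) ∈ T := Or.inr rfl
  have hfin : T.Finite := by
    refine Set.Finite.union (Set.Finite.subset ((Set.finite_Icc 1 (k / 2 - 1)).image
      fun s => graphSpectralRadius (graphW n (k - 1) s)) ?_) (Set.finite_singleton _)
    rintro x ⟨s, h1, h2, rfl⟩
    exact ⟨s, ⟨h1, h2⟩, rfl⟩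
  have hWle : ∀ s, 2 * s + 2 ≤ k →
      graphSpectralRadius (graphW n (k - 1) s) ≤ graphSpectralRadius G := by
    intro s hs
    set e := Fintype.equivFinOfCardEq hV
    refine le_trans (graphSpectralRadius_mono e.symm e.symm.injective ?_)
      (hmax ((graphW n (k - 1) s).comap e)
        (free_pathGraph_of_embedding e e.injective (fun _ _ h => h) (graphW_free n k s hs)))
    intro u v h
    simpa using h
  have hupper : ∀ x ∈ T, x ≤ graphSpectralRadius G := by
    rintro x (⟨s, -, h2, rfl⟩ | rfl)
    · exact hWle s (by omega)
    · have hle : k - 1 ≤ n := by omega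
      refine (graphSpectralRadius_mono (Fin.castLE hle) (Fin.castLE_injective hle) ?_).trans
        (hWle 0 (by omega))
      intro u v h
      exact ⟨fun e => h.ne (Fin.castLE_injective hle e), Or.inl ⟨u.isLt, v.isLt⟩⟩
  -- The upper bound is applied with `M` the largest candidate, so equality also gives membership in
  -- `T`.
  obtain ⟨M, hMT, hMmax⟩ := Set.exists_max_image T id hfin ⟨_, hTK⟩
  have hGM : graphSpectralRadius G ≤ M :=
    graphSpectralRadius_le_of_free (by omega) hV hfree (hMmax _ hTK)
      fun s h1 h2 => hMmax _ (hTW s h1 h2)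
  have heq : graphSpectralRadius G = M := le_antisymm hGM (hupper M hMT)
  exact ⟨heq ▸ hMT, hupper⟩
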